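/- Let $X$ be a non-empty metric space and let $C>0$. A $(1,C)$-quasi-geodesic from $x$ to $y$ is a (not necessarily continuous) map $\gamma:[0,a]\to X$, $a\ge 0$, with $\gamma(0)=x$, $\gamma(a)=y$ and $\big|d(\gamma(s),\gamma(t))-|s-t|\big|\le C$ for all $s,t\in[0,a]$. Let $\kappa:\mathbb R\to[0,\infty)$ be non-decreasing and sublinear, that is, $\kappa(t)/t\to 0$ as $t\to\infty$. The space $X$ is asymptotically CAT(0) with parameters $C,\kappa$ if 1. any two points of $X$ are joined by a $(1,C)$-quasi-geodesic, and 2. for every triangle in $X$ whose sides are $(1,C)$-quasi-geodesics (each side running between two of the vertices in either direction), every comparison triangle in the Euclidean plane (a possibly degenerate triangle whose vertices have the same pairwise distances), all points $p,q$ on the triangle, and all comparison points $\bar p,\bar q$ for them, $$d(p,q)\le |\bar p-\bar q|+\kappa(\delta(p))+\kappa(\delta(q)).$$ Here, if $p$ lies on the side from $x$ to $y$, then a comparison point for $p$ is a point $\bar p$ of the segment $[\bar x,\bar y]$ with $\big|d(p,x)-|\bar p-\bar x|\big|\le C$, and $\delta(p)=\min\{d(x,p),d(p,y)\}-C$. For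 $B\subseteq X$ and $T\in\mathbb R$ let $R_T(B)$ be the Vietoris–Rips complex: its simplices are the non-empty finite subsets of $B$ whose points are at pairwise distance at most $T$. Geometric realizations $|\cdot|$ carry the weak topology. **Theorem.** Let $X$ be non-empty and asymptotically CAT(0) with parameters $C,\kappa$. (a) For all sufficiently large $T$, the space $|R_T(X)|$ is contractible. (b) For all sufficiently large $T$ the following holds. For every (open or closed) metric ball $B$ of $X$, every simplicial complex $\mathbf P$ (not necessarily finite) and every simplicial map $\theta:\mathbf P\to R_T(B)$, there is a simplicial homotopy inside $R_T(N_{T+C}(B))$ from $\theta$ to a constant simplicial map, where $N_{r}(B)=\{x\in X: d(x,b)<r\text{ for some }b\in B\}$. That is, there are a simplicial complex $\mathbf K$, a homeomorphism $\varphi:|\mathbf K|\to|\mathbf P|\times[0,1]$ and a simplicial map $h:\mathbf K\to R_T(N_{T+C}(B))$ such that $|h|\circ\varphi^{-1}$ agrees with $|\theta|$ on $|\mathbf P|\times\{0\}$ and with the realization of a constant simplicial map on $|\mathbf P|\times\{1\}$. -/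

import Mathlib

open Filter Topology

/-! ### Simplicial complexes, their geometric realizations, simplicial maps and homotopies -/

universe u v

/-- The geometric realization of an abstract simplicial complex: finitely supported barycentric
coordinates, non-negative and of total sum `1`, whose support is a face. -/
def Realization {V : Type u} (K : PreAbstractSimplicialComplex V) : Type u :=
  {x : V →₀ ℝ // (∀ v, 0 ≤ x v) ∧ (x.sum fun _ a => a) = 1 ∧ x.support ∈ K.faces}

/-- The closed simplex of the realization spanned by the finite set `s` of vertices. -/
def closedSimplex {V : Type u} (K : PreAbstractSimplicialComplex V) (s : Finset V) :
    Set (Realization K) :=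
  {x | x.1.support ⊆ s}

/-- The weak topology: each closed simplex of `K` carries its Euclidean topology (the one given by
the barycentric coordinates), and a set is open as soon as its trace on each closed simplex
is open. -/
instance Realization.instTopologicalSpace {V : Type u} (K : PreAbstractSimplicialComplex V) :
    TopologicalSpace (Realization K) :=
  ⨆ s : K.faces, TopologicalSpace.coinduced
    (Subtype.val : closedSimplex K (s : Finset V) → Realization K)
    (TopologicalSpace.induced (fun x (v : V) => x.1.1 v) inferInstance)

/-- A simplicial map: a map of vertices that sends faces to faces. -/
structure SimplicialMap {V : Type u} {W : Type v} (K : PreAbstractSimplicialComplex V)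
    (L : PreAbstractSimplicialComplex W) where
  toFun : V → W
  image_mem : ∀ s ∈ K.faces, ∃ t ∈ L.faces, (t : Set W) = toFun '' (s : Set V)

theorem mapDomain_apply_nonneg {V : Type u} {W : Type v} (f : V → W) (x : V →₀ ℝ)
    (hx : ∀ v, 0 ≤ x v) (w : W) : 0 ≤ Finsupp.mapDomain f x w := by
  classical
  rw [Finsupp.mapDomain, Finsupp.sum_apply, Finsupp.sum]
  refine Finset.sum_nonneg fun v _ => ?_
  rw [Finsupp.single_apply]
  split_ifs
  · exact hx v
  · exact le_rfl

theorem mapDomain_support_of_nonneg {V : Type u} {W : Type v} (f : V → W) (x : V →₀ ℝ)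
    (hx : ∀ v, 0 ≤ x v) :
    ((Finsupp.mapDomain f x).support : Set W) = f '' (x.support : Set V) := by
  classical
  apply Set.Subset.antisymm
  · intro w hw
    have h := Finsupp.mapDomain_support (f := f) (s := x) hw
    simpa using h
  · rintro _ ⟨v, hv, rfl⟩
    have hv' : x v ≠ 0 := by simpa using hv
    have hpos : 0 < x v := lt_of_le_of_ne (hx v) (Ne.symm hv')
    have hle : x v ≤ Finsupp.mapDomain f x (f v) := by
      rw [Finsupp.mapDomain, Finsupp.sum_apply, Finsupp.sum]
      have h1 : x v = (Finsupp.single (f v) (x v)) (f v) := by simp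
      conv_lhs => rw [h1]
      refine Finset.single_le_sum (f := fun a => (Finsupp.single (f a) (x a)) (f v))
        (fun a _ => ?_) (Finsupp.mem_support_iff.2 hv')
      rw [Finsupp.single_apply]
      split_ifs
      · exact hx a
      · exact le_rfl
    simpa using (lt_of_lt_of_le hpos hle).ne'

/-- The map of realizations induced by a simplicial map: affine on each simplex. -/
noncomputable def SimplicialMap.realize {V : Type u} {W : Type v}
    {K : PreAbstractSimplicialComplex V} {L : PreAbstractSimplicialComplex W}
    (f : SimplicialMap K L) (x : Realization K) : Realization L :=
  ⟨Finsupp.mapDomain f.toFun x.1, mapDomain_apply_nonneg f.toFun x.1 x.2.1, by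
    rw [Finsupp.sum_mapDomain_index (fun _ => rfl) (fun _ _ _ => rfl)]
    exact x.2.2.1, by
    obtain ⟨t, ht, hts⟩ := f.image_mem _ x.2.2.2
    rw [← mapDomain_support_of_nonneg f.toFun x.1 x.2.1] at hts
    rwa [← Finset.coe_injective hts]⟩

/-- Two simplicial maps `f`, `g` from `P` into complexes `L₀`, `L₁` on the vertex set `W` are
simplicially homotopic inside a complex `L` on `W` if there are a triangulation of `|P| × [0, 1]`
and a simplicial map from it to `L` which is `f` at time `0` and `g` at time `1`. -/
def SimpliciallyHomotopicInside {V : Type u} {W : Type v} {P : PreAbstractSimplicialComplex V}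
    {L₀ L₁ : PreAbstractSimplicialComplex W} (L : PreAbstractSimplicialComplex W)
    (f : SimplicialMap P L₀) (g : SimplicialMap P L₁) : Prop :=
  ∃ (U : Type u) (K : PreAbstractSimplicialComplex U)
    (φ : Realization K ≃ₜ Realization P × unitInterval) (h : SimplicialMap K L),
    (∀ x, (φ x).2 = 0 → (h.realize x).1 = (f.realize (φ x).1).1) ∧
    (∀ x, (φ x).2 = 1 → (h.realize x).1 = (g.realize (φ x).1).1)

/-- The Vietoris–Rips complex `R_T(B)` of a subset `B` of a metric space. -/
def vietorisRips {X : Type u} [MetricSpace X] (T : ℝ) (B : Set X) :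
    PreAbstractSimplicialComplex X where
  faces := {s | s.Nonempty ∧ (s : Set X) ⊆ B ∧ ∀ x ∈ s, ∀ y ∈ s, dist x y ≤ T}
  isRelLowerSet_faces := by
    intro s hs
    refine ⟨hs.1, fun t hts ht => ⟨ht, ?_, ?_⟩⟩
    · exact fun x hx => hs.2.1 (hts hx)
    · exact fun x hx y hy => hs.2.2 x (hts hx) y (hts hy)

/-! ### Asymptotically CAT(0) spaces -/

/-- `γ : [0, a] → X` is a `(1, C)`-quasi-geodesic (only the values on `[0, a]` matter, and `γ` need
not be continuous). -/
def IsQuasiGeodesic {X : Type u} [MetricSpace X] (C a : ℝ) (γ : ℝ → X) : Prop :=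
  0 ≤ a ∧ ∀ s ∈ Set.Icc 0 a, ∀ t ∈ Set.Icc 0 a,
    |s - t| - C ≤ dist (γ s) (γ t) ∧ dist (γ s) (γ t) ≤ |s - t| + C

/-- A triangle of `(1, C)`-quasi-geodesics. The side `i` is opposite to the vertex `i`; it runs from
the vertex `src i` to the vertex `tgt i`, and may be traversed in either of the two directions. -/
structure QuasiGeodesicTriangle (X : Type u) [MetricSpace X] (C : ℝ) where
  vertex : Fin 3 → X
  src : Fin 3 → Fin 3
  tgt : Fin 3 → Fin 3
  src_ne : ∀ i, src i ≠ i
  tgt_ne : ∀ i, tgt i ≠ i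
  src_ne_tgt : ∀ i, src i ≠ tgt i
  length : Fin 3 → ℝ
  side : Fin 3 → ℝ → X
  isQuasiGeodesic : ∀ i, IsQuasiGeodesic C (length i) (side i)
  side_zero : ∀ i, side i 0 = vertex (src i)
  side_length : ∀ i, side i (length i) = vertex (tgt i)

/-- `δ_{x,y}(p) = min {d(x,p), d(p,y)} - C`. -/
noncomputable def sideDepth {X : Type u} [MetricSpace X] (C : ℝ) (x y p : X) : ℝ :=
  min (dist x p) (dist p y) - C

/-- For a point `p` on a `(1, C)`-quasi-geodesic from `x` to `y`, the point `p'` of the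
Euclidean segment `[x', y']` is a comparison point for `p`. -/
def IsComparisonPoint {X : Type u} [MetricSpace X] (C : ℝ) (x p : X)
    (x' y' p' : EuclideanSpace ℝ (Fin 2)) : Prop :=
  p' ∈ segment ℝ x' y' ∧ |dist p x - dist p' x'| ≤ C

/-- The triangle `Δ` satisfies the CAT(0) condition up to `κ`: for every Euclidean comparison
triangle `c`, all points `p`, `q` on the triangle (possibly on the same side) and all comparison
points `p'`, `q'` for them, `d(p,q) ≤ d(p',q') + κ(δ(p)) + κ(δ(q))`. -/
def QuasiGeodesicTriangle.SatisfiesCAT0UpTo {X : Type u} [MetricSpace X] {C : ℝ}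
    (Δ : QuasiGeodesicTriangle X C) (κ : ℝ → ℝ) : Prop :=
  ∀ c : Fin 3 → EuclideanSpace ℝ (Fin 2),
    (∀ i j, dist (c i) (c j) = dist (Δ.vertex i) (Δ.vertex j)) →
    ∀ i j : Fin 3, ∀ s ∈ Set.Icc 0 (Δ.length i), ∀ t ∈ Set.Icc 0 (Δ.length j),
    ∀ p' q' : EuclideanSpace ℝ (Fin 2),
      IsComparisonPoint C (Δ.vertex (Δ.src i)) (Δ.side i s) (c (Δ.src i)) (c (Δ.tgt i)) p' →
      IsComparisonPoint C (Δ.vertex (Δ.src j)) (Δ.side j t) (c (Δ.src j)) (c (Δ.tgt j)) q' →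
      dist (Δ.side i s) (Δ.side j t) ≤ dist p' q'
        + κ (sideDepth C (Δ.vertex (Δ.src i)) (Δ.vertex (Δ.tgt i)) (Δ.side i s))
        + κ (sideDepth C (Δ.vertex (Δ.src j)) (Δ.vertex (Δ.tgt j)) (Δ.side j t))

/-- `X` is asymptotically CAT(0) with parameters `C` and `κ`. As the argument of `κ` can be as small
as `-C`, the function `κ` is taken to be defined on all of `ℝ`; a function given on `[0, ∞)` is
to be extended by its value at `0`. -/
structure IsAsymptoticallyCAT0 (X : Type u) [MetricSpace X] (C : ℝ) (κ : ℝ → ℝ) : Prop where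
  pos : 0 < C
  nonneg : ∀ t, 0 ≤ κ t
  monotone : Monotone κ
  sublinear : Tendsto (fun t => κ t / t) atTop (𝓝 0)
  exists_quasiGeodesic : ∀ x y : X, ∃ (a : ℝ) (γ : ℝ → X),
    IsQuasiGeodesic C a γ ∧ γ 0 = x ∧ γ a = y
  cat0 : ∀ Δ : QuasiGeodesicTriangle X C, Δ.SatisfiesCAT0UpTo κ

/-- Open and closed metric balls. -/
def IsMetricBall {X : Type u} [MetricSpace X] (B : Set X) : Prop :=
  ∃ (x : X) (r : ℝ), B = Metric.closedBall x r ∨ B = Metric.ball x r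

/-!
The idea is to make the vertices of a map into the Vietoris–Rips complex approach a base point `x₀`
step by step, subdividing at each step.

*Geometry.* Let `F` be a finite set of diameter at most `T`, and let `c` nearly minimize the radius
of the balls containing `F`. The CAT(0) comparison, applied to points near `c` on a quasi-geodesic
from `c` to `z`, bounds `dist c z ^ 2` by about the difference of the squared radii at `z` and at
`c` (`mul_dist_sq_le`). With `z` in `F` this is an approximate Jung theorem: the radius is about
`3 / 4 * T` at most (`eccentricity_sq_le`). With `z` the near circumcentre of a larger set, it bounds
the distance of the two centres by `4 / 5 * T` (`dist_circumcenters_le`). As `κ` is sublinear, all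
errors are small fractions of `T` for large `T`. There remains room to move each centre by `T / 16`
towards `x₀`; as near circumcentres hardly leave the balls around `x₀` that contain `F`
(`dist_circumcenter_le`), the moved centre is closer to `x₀` than `F` by `T / 64`. This is
`exists_isCenterChoice`.

*Topology.* The prism over a complex `P`, with `P` at the bottom and its barycentric subdivision at
the top, triangulates `|P| × [0, 1]` (`prismHomeomorph`). By the above, a simplicial map `θ` from
`P` extends to this prism by sending a face `s` at the top to the centre of `θ s`
(`prismSimplicialMap`).

For (b), prisms over iterated subdivisions are glued on top of each other (`stackHomeomorph`). After
finitely many of them the map is constant, since the image lies in a ball around `x₀` whose radius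
decreases by `T / 64` each time. In fact the homotopy stays in the Vietoris–Rips complex of `B`.

For (a), the same construction with `θ` the identity gives a homotopy from the identity of the
realization to a map `G` which shrinks the balls around `x₀`. The concatenation of this homotopy
with its composites with the iterates of `G` reaches `x₀` after a time that is bounded by a
continuous function of the point, and this contracts the space (`contractibleSpace_of_shrinking`).
-/

/-! ### The weak topology on a realization -/

namespace Realization

variable {V : Type*} {W : Type*} {K : PreAbstractSimplicialComplex V}
  {L : PreAbstractSimplicialComplex W}

theorem mem_closedSimplex {s : Finset V} {x : Realization K} :
    x ∈ closedSimplex K s ↔ x.1.support ⊆ s := Iff.rfl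

theorem nonneg (x : Realization K) (v : V) : 0 ≤ x.1 v := x.2.1 v

theorem sum_eq_one (x : Realization K) : (x.1.sum fun _ a => a) = 1 := x.2.2.1

theorem support_mem (x : Realization K) : x.1.support ∈ K.faces := x.2.2.2

theorem continuous_closedSimplex_val {s : Finset V} (hs : s ∈ K.faces) :
    Continuous[TopologicalSpace.induced (fun (x : closedSimplex K s) (v : V) => x.1.1 v)
      inferInstance, Realization.instTopologicalSpace K]
      (Subtype.val : closedSimplex K s → Realization K) := by
  rw [continuous_iff_coinduced_le]
  exact le_iSup (fun s : K.faces => TopologicalSpace.coinduced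
    (Subtype.val : closedSimplex K (s : Finset V) → Realization K)
    (TopologicalSpace.induced (fun x (v : V) => x.1.1 v) inferInstance)) ⟨s, hs⟩

theorem continuous_of_closedSimplex {Z : Type*} [TopologicalSpace Z] {f : Realization K → Z}
    (h : ∀ s ∈ K.faces, ContinuousOn f (closedSimplex K s)) : Continuous f := by
  refine continuous_iSup_dom.2 fun s => continuous_coinduced_dom.2 ?_
  have h1 := continuousOn_iff_continuous_domRestrict.1 (h s s.2)
  let t : TopologicalSpace (closedSimplex K (s : Finset V)) :=
    TopologicalSpace.induced (fun x (v : V) => x.1.1 v) inferInstance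
  have h2 : Continuous[t, instTopologicalSpaceSubtype]
      (id : closedSimplex K (s : Finset V) → closedSimplex K (s : Finset V)) :=
    continuous_induced_rng.2 (continuous_closedSimplex_val s.2)
  exact @Continuous.comp _ _ _ t instTopologicalSpaceSubtype _ id
    ((closedSimplex K (s : Finset V)).domRestrict f) h1 h2

@[fun_prop]
theorem continuous_coord (v : V) : Continuous fun x : Realization K => x.1 v := by
  refine continuous_iSup_dom.2 fun s => continuous_coinduced_dom.2 ?_
  let t : TopologicalSpace (closedSimplex K (s : Finset V)) :=
    TopologicalSpace.induced (fun x (v : V) => x.1.1 v) inferInstance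
  have h2 : Continuous[t, _] fun (x : closedSimplex K (s : Finset V)) (v : V) => x.1.1 v :=
    continuous_induced_dom
  have h3 : Continuous[t, _] fun x : closedSimplex K (s : Finset V) => x.1.1 v :=
    (continuous_apply v).comp h2
  exact h3

/-- On a closed simplex, the weak topology restricts to the Euclidean topology. -/
theorem isInducing_coord_closedSimplex {s : Finset V} (hs : s ∈ K.faces) :
    IsInducing fun (x : closedSimplex K s) (v : V) => x.1.1 v := by
  refine ⟨le_antisymm ?_ ?_⟩
  · refine continuous_iff_le_induced.1 ?_
    exact continuous_pi fun v => (continuous_coord v).comp continuous_subtype_val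
  · have := continuous_closedSimplex_val hs
    exact continuous_iff_le_induced.1 this

instance : T2Space (Realization K) :=
  T2Space.of_injective_continuous (f := fun (x : Realization K) (v : V) => x.1 v)
    (fun _ _ h => Subtype.ext (Finsupp.ext fun v => congrFun h v))
    (continuous_pi fun v => continuous_coord v)

theorem isCompact_closedSimplex_of_mem {s : Finset V} (hs : s ∈ K.faces) :
    IsCompact (closedSimplex K s) := by
  classical
  rw [isCompact_iff_compactSpace, ← isCompact_univ_iff,
    (isInducing_coord_closedSimplex hs).isCompact_iff, Set.image_univ]
  have hr : Set.range (fun (x : closedSimplex K s) (v : V) => x.1.1 v) =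
      (Set.univ.pi fun _ : V => Set.Icc (0 : ℝ) 1) ∩
        ({y | ∀ v ∉ s, y v = 0} ∩ {y | ∑ v ∈ s, y v = 1}) := by
    ext y
    constructor
    · rintro ⟨⟨x, hx⟩, rfl⟩
      have hsum : ∑ v ∈ s, x.1 v = 1 := by
        refine Eq.trans ?_ x.sum_eq_one
        rw [Finsupp.sum_of_support_subset _ hx _ (fun _ _ => rfl)]
      have h0 : ∀ v ∉ s, x.1 v = 0 := fun v hv =>
        Finsupp.notMem_support_iff.1 fun h => hv (hx h)
      refine ⟨fun v _ => ⟨x.nonneg v, ?_⟩, h0, hsum⟩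
      by_cases hv : v ∈ s
      · refine le_of_le_of_eq ?_ hsum
        exact Finset.single_le_sum (f := fun v => x.1 v) (fun v _ => x.nonneg v) hv
      · simp [h0 v hv]
    · rintro ⟨h1, h2, h3⟩
      let z : V →₀ ℝ := Finsupp.onFinset s y fun v hv => by
        by_contra h
        exact hv (h2 v h)
      have hz : z.support ⊆ s := Finsupp.support_onFinset_subset
      have hzs : (z.sum fun _ a => a) = 1 := by
        rw [Finsupp.sum_of_support_subset _ hz _ (fun _ _ => rfl)]
        exact h3
      have hne : z.support.Nonempty := by
        rw [Finset.nonempty_iff_ne_empty]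
        intro h
        simp [Finsupp.sum, h] at hzs
      exact ⟨⟨⟨z, fun v => (h1 v trivial).1, hzs, (K.isRelLowerSet_faces hs).2 hz hne⟩, hz⟩, rfl⟩
  rw [hr]
  refine (isCompact_univ_pi fun _ => isCompact_Icc).inter_right (IsClosed.inter ?_ ?_)
  · simp only [Set.ofPred_forall]
    exact isClosed_iInter fun v => isClosed_iInter fun _ =>
      isClosed_eq (continuous_apply v) continuous_const
  · exact isClosed_eq (continuous_finsetSum _ fun v _ => continuous_apply v) continuous_const

/-- The full subcomplex spanned by finitely many vertices is compact, whether or not they span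
a simplex. -/
theorem isCompact_closedSimplex (D : Finset V) : IsCompact (closedSimplex K D) := by
  have h : closedSimplex K D = ⋃ s ∈ {s | s ∈ D.powerset ∧ s ∈ K.faces}, closedSimplex K s := by
    ext x
    simp only [Set.mem_iUnion, Set.mem_ofPred_eq, Finset.mem_powerset, mem_closedSimplex]
    constructor
    · intro hx
      exact ⟨x.1.support, ⟨hx, x.support_mem⟩, Finset.Subset.refl _⟩
    · rintro ⟨s, ⟨hs, -⟩, hx⟩
      exact Finset.Subset.trans hx hs
  rw [h]
  refine Set.Finite.isCompact_biUnion ?_ fun s hs => isCompact_closedSimplex_of_mem hs.2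
  exact (Finset.finite_toSet D.powerset).subset fun s hs => hs.1

/-- The affine extension of a real function on the vertices is continuous. -/
theorem continuous_sum_mul (c : V → ℝ) :
    Continuous fun x : Realization K => x.1.sum fun v a => a * c v := by
  refine continuous_of_closedSimplex fun s _ => ?_
  have h : ContinuousOn (fun x : Realization K => ∑ v ∈ s, x.1 v * c v) (closedSimplex K s) := by
    fun_prop
  refine h.congr fun x hx => ?_
  exact Finsupp.sum_of_support_subset _ hx _ (fun _ _ => zero_mul _)

/-- A map between realizations which is affine on each closed simplex, with image in a closed
simplex, is continuous. -/
theorem continuous_of_affine {F : Realization K → Realization L} (m : V → W →₀ ℝ)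
    (hF : ∀ x, (F x).1 = Finsupp.linearCombination ℝ m x.1)
    (hm : ∀ s ∈ K.faces, ∃ t ∈ L.faces, ∀ v ∈ s, (m v).support ⊆ t) : Continuous F := by
  classical
  refine continuous_of_closedSimplex fun s hs => ?_
  obtain ⟨t, ht, hst⟩ := hm s hs
  have hmem : ∀ x ∈ closedSimplex K s, F x ∈ closedSimplex L t := by
    intro x hx w hw
    by_contra hwt
    rw [Finsupp.mem_support_iff, hF, Finsupp.linearCombination_apply, Finsupp.sum_apply] at hw
    refine hw (Finset.sum_eq_zero fun v hv => ?_)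
    have : m v w = 0 := Finsupp.notMem_support_iff.1 fun h => hwt (hst v (hx hv) h)
    simp [this]
  rw [continuousOn_iff_continuous_domRestrict]
  have h1 : Continuous (fun x : closedSimplex K s =>
      (⟨F x.1, hmem x.1 x.2⟩ : closedSimplex L t)) := by
    rw [(isInducing_coord_closedSimplex ht).continuous_iff]
    refine continuous_pi fun w => ?_
    have h2 : Continuous fun x : closedSimplex K s => x.1.1.sum fun v a => a * m v w :=
      (continuous_sum_mul fun v => m v w).comp continuous_subtype_val
    refine h2.congr fun x => ?_
    simp [hF, Finsupp.linearCombination_apply, Finsupp.sum_apply]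
  exact continuous_subtype_val.comp h1

theorem continuous_realize (f : SimplicialMap K L) : Continuous f.realize := by
  classical
  refine continuous_of_affine (fun v => Finsupp.single (f.toFun v) 1) (fun x => ?_)
    fun s hs => ?_
  · simp [SimplicialMap.realize, Finsupp.linearCombination_apply, Finsupp.mapDomain]
  · obtain ⟨t, ht, hts⟩ := f.image_mem s hs
    refine ⟨t, ht, fun v hv => ?_⟩
    refine Finsupp.support_single_subset.trans ?_
    rw [Finset.singleton_subset_iff, ← Finset.mem_coe, hts]
    exact Set.mem_image_of_mem _ hv

/-- The product of a realization with the unit interval carries the weak topology with respect to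
the prisms over the closed simplices. -/
theorem continuous_prod_of_closedSimplex {Z : Type*} [TopologicalSpace Z]
    {f : Realization K × unitInterval → Z}
    (h : ∀ s ∈ K.faces, ContinuousOn f (closedSimplex K s ×ˢ Set.univ)) : Continuous f := by
  have h1 : ∀ x, Continuous fun t => f (x, t) := by
    intro x
    refine continuousOn_univ.1 ?_
    refine (h _ x.support_mem).comp (Continuous.continuousOn (by fun_prop)) ?_
    intro t _
    exact ⟨Finset.Subset.refl _, trivial⟩
  -- The unit interval is locally compact, so that `f` may be curried.
  have h2 : Continuous fun x => (⟨fun t => f (x, t), h1 x⟩ : C(unitInterval, Z)) := by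
    refine continuous_of_closedSimplex fun s hs => ?_
    rw [continuousOn_iff_continuous_domRestrict]
    have h3 : Continuous fun p : closedSimplex K s × unitInterval => f (p.1.1, p.2) := by
      rw [← continuousOn_univ]
      exact (h s hs).comp (Continuous.continuousOn (by fun_prop)) fun p _ => ⟨p.1.2, trivial⟩
    exact (ContinuousMap.curry ⟨_, h3⟩).continuous
  exact ContinuousMap.continuous_uncurry_of_continuous ⟨_, h2⟩

end Realization

/-- The inverse of a continuous map is continuous on the images of compact sets. -/
theorem continuousOn_of_leftInverse_of_isCompact {Y Z : Type*} [TopologicalSpace Y]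
    [TopologicalSpace Z] [T2Space Z] {f : Y → Z} (hf : Continuous f) {g : Z → Y}
    (hgf : Function.LeftInverse g f) {S : Set Z} {M : Set Y} (hM : IsCompact M)
    (hS : S ⊆ f '' M) : ContinuousOn g S := by
  rw [continuousOn_iff_isClosed]
  intro C hC
  refine ⟨f '' (M ∩ C), ((hM.inter_right hC).image hf).isClosed, ?_⟩
  ext z
  constructor
  · rintro ⟨hz, hzS⟩
    obtain ⟨y, hy, rfl⟩ := hS hzS
    refine ⟨⟨y, ⟨hy, ?_⟩, rfl⟩, hzS⟩
    simpa [hgf y] using hz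
  · rintro ⟨⟨y, ⟨hy, hyC⟩, rfl⟩, hzS⟩
    refine ⟨?_, hzS⟩
    simpa [hgf y] using hyC

/-! ### Barycentres and flags -/

section Barycenter

variable {V : Type*}

/-- The barycentre of the simplex spanned by `s`, in barycentric coordinates; it is `0` if `s` is
empty. -/
noncomputable def barycenter (s : Finset V) : V →₀ ℝ :=
  Finsupp.indicator s fun _ _ => (s.card : ℝ)⁻¹

theorem barycenter_apply_of_mem {s : Finset V} {v : V} (hv : v ∈ s) :
    barycenter s v = (s.card : ℝ)⁻¹ :=
  Finsupp.indicator_of_mem hv _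

theorem barycenter_apply_of_notMem {s : Finset V} {v : V} (hv : v ∉ s) : barycenter s v = 0 :=
  Finsupp.indicator_of_notMem hv _

theorem barycenter_nonneg (s : Finset V) (v : V) : 0 ≤ barycenter s v := by
  by_cases hv : v ∈ s
  · rw [barycenter_apply_of_mem hv]
    positivity
  · rw [barycenter_apply_of_notMem hv]

theorem barycenter_support_subset (s : Finset V) : (barycenter s).support ⊆ s :=
  Finsupp.support_indicator_subset _ _

theorem degree_eq_sum_of_support_subset {x : V →₀ ℝ} {s : Finset V} (h : x.support ⊆ s) :
    x.degree = ∑ v ∈ s, x v :=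
  Finsupp.sum_of_support_subset x h (fun _ a => a) fun _ _ => rfl

theorem degree_barycenter {s : Finset V} (hs : s.Nonempty) : (barycenter s).degree = 1 := by
  rw [degree_eq_sum_of_support_subset (barycenter_support_subset s),
    Finset.sum_congr rfl fun v hv => barycenter_apply_of_mem hv, Finset.sum_const, nsmul_eq_mul]
  exact mul_inv_cancel₀ (by exact_mod_cast hs.card_pos.ne')

theorem degree_smul_real (r : ℝ) (x : V →₀ ℝ) : (r • x).degree = r * x.degree := by
  rw [degree_eq_sum_of_support_subset (Finsupp.support_smul (b := r) (g := x)),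
    degree_eq_sum_of_support_subset (Finset.Subset.refl x.support), Finset.mul_sum]
  rfl

theorem degree_linearCombination {W : Type*} (m : V → W →₀ ℝ) (x : V →₀ ℝ)
    (h : ∀ v ∈ x.support, (m v).degree = 1) :
    (Finsupp.linearCombination ℝ m x).degree = x.degree := by
  rw [Finsupp.linearCombination_apply, Finsupp.sum, map_sum,
    degree_eq_sum_of_support_subset (Finset.Subset.refl x.support)]
  refine Finset.sum_congr rfl fun v hv => ?_
  rw [degree_smul_real, h v hv, mul_one]

theorem eq_zero_of_degree_eq_zero {x : V →₀ ℝ} (h0 : ∀ v, 0 ≤ x v) (h : x.degree = 0) :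
    x = 0 := by
  ext v
  by_contra hv
  have hv' : v ∈ x.support := Finsupp.mem_support_iff.2 hv
  exact hv ((Finset.sum_eq_zero_iff_of_nonneg fun v _ => h0 v).1 h v hv')

theorem eq_of_le_of_degree_eq {x y : V →₀ ℝ} (h : ∀ v, x v ≤ y v) (hd : x.degree = y.degree) :
    x = y := by
  have h1 : y - x = 0 := eq_zero_of_degree_eq_zero (fun v => by simpa using h v) (by
    rw [map_sub, hd, sub_self])
  exact (sub_eq_zero.1 h1).symm

theorem linearCombination_coord {W : Type*} (m : V → W →₀ ℝ) (x : V →₀ ℝ) (w : W) :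
    Finsupp.linearCombination ℝ m x w = ∑ v ∈ x.support, x v * m v w := by
  simp [Finsupp.linearCombination_apply, Finsupp.sum, Finsupp.finsetSum_apply]

theorem linearCombination_coord_nonneg {W : Type*} {m : V → W →₀ ℝ} {x : V →₀ ℝ}
    (hx : ∀ v, 0 ≤ x v) (hm : ∀ v w, 0 ≤ m v w) (w : W) :
    0 ≤ Finsupp.linearCombination ℝ m x w := by
  rw [linearCombination_coord]
  exact Finset.sum_nonneg fun v _ => mul_nonneg (hx v) (hm v w)

theorem exists_greatest_of_isChain {c : Finset (Finset V)}
    (hc : IsChain (· ⊆ ·) (c : Set (Finset V))) (hne : c.Nonempty) : ∃ U ∈ c, ∀ s ∈ c, s ⊆ U := by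
  obtain ⟨U, hU, hmax⟩ := c.exists_max_image Finset.card hne
  refine ⟨U, hU, fun s hs => ?_⟩
  rcases hc.total hs hU with h | h
  · exact h
  · exact (Finset.eq_of_subset_of_card_le h (hmax s hs)).ge

/-- Non-negative weights on a flag (a chain, for inclusion, of non-empty finite sets). -/
structure IsFlagWeight (b : Finset V →₀ ℝ) : Prop where
  nonneg : ∀ s, 0 ≤ b s
  nonempty : ∀ s ∈ b.support, s.Nonempty
  chain : IsChain (· ⊆ ·) (b.support : Set (Finset V))

/-- The combination of the barycentres of the sets of a flag, with weights `b`. -/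
noncomputable def flagSum (b : Finset V →₀ ℝ) : V →₀ ℝ :=
  Finsupp.linearCombination ℝ barycenter b

namespace IsFlagWeight

variable {b b' : Finset V →₀ ℝ}

theorem erase (hb : IsFlagWeight b) (s : Finset V) : IsFlagWeight (b.erase s) := by
  classical
  refine ⟨fun t => ?_, fun t ht => ?_, ?_⟩
  · rw [Finsupp.erase_apply]
    split_ifs
    · exact le_rfl
    · exact hb.nonneg t
  · rw [Finsupp.support_erase] at ht
    exact hb.nonempty t (Finset.mem_of_mem_erase ht)
  · rw [Finsupp.support_erase]
    exact hb.chain.mono (by simp)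

theorem flagSum_nonneg (hb : IsFlagWeight b) (v : V) : 0 ≤ flagSum b v :=
  linearCombination_coord_nonneg hb.nonneg barycenter_nonneg v

theorem degree_flagSum (hb : IsFlagWeight b) : (flagSum b).degree = b.degree :=
  degree_linearCombination _ _ fun s hs => degree_barycenter (hb.nonempty s hs)

/-- The largest set of a flag is the support of the weighted sum, and its weight can be read off
from the minimal value on it. -/
theorem exists_top (hb : IsFlagWeight b) (h0 : b ≠ 0) :
    ∃ U ∈ b.support, (∀ s ∈ b.support, s ⊆ U) ∧ (flagSum b).support = U ∧
      (∃ v ∈ U, flagSum b v = b U * (U.card : ℝ)⁻¹) ∧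
      ∀ v ∈ U, b U * (U.card : ℝ)⁻¹ ≤ flagSum b v := by
  classical
  obtain ⟨U, hU, hmax⟩ := exists_greatest_of_isChain hb.chain (Finsupp.support_nonempty_iff.2 h0)
  have hsplit : ∀ v, flagSum b v = b U * barycenter U v + flagSum (b.erase U) v := by
    intro v
    conv_lhs => rw [← Finsupp.single_add_erase U b]
    simp [flagSum, map_add]
  have hge : ∀ v ∈ U, b U * (U.card : ℝ)⁻¹ ≤ flagSum b v := by
    intro v hv
    rw [hsplit, barycenter_apply_of_mem hv]
    linarith [(hb.erase U).flagSum_nonneg v]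
  have hbU : 0 < b U := lt_of_le_of_ne (hb.nonneg U) (Ne.symm (Finsupp.mem_support_iff.1 hU))
  have hcard : 0 < (U.card : ℝ) := by exact_mod_cast (hb.nonempty U hU).card_pos
  refine ⟨U, hU, hmax, ?_, ?_, hge⟩
  · ext v
    rw [Finsupp.mem_support_iff]
    constructor
    · intro hv
      by_contra hvU
      rw [flagSum, linearCombination_coord] at hv
      refine hv (Finset.sum_eq_zero fun s hs => ?_)
      rw [barycenter_apply_of_notMem fun h => hvU (hmax s hs h), mul_zero]
    · intro hv
      have := hge v hv
      have h2 : 0 < b U * (U.card : ℝ)⁻¹ := by positivity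
      exact (lt_of_lt_of_le h2 this).ne'
  · by_cases he : b.erase U = 0
    · obtain ⟨v, hv⟩ := hb.nonempty U hU
      refine ⟨v, hv, ?_⟩
      rw [hsplit, he, barycenter_apply_of_mem hv]
      simp [flagSum]
    · -- A vertex of `U` outside the second largest set of the flag.
      obtain ⟨U', hU', hmax'⟩ := exists_greatest_of_isChain (hb.erase U).chain
        (Finsupp.support_nonempty_iff.2 he)
      have hU'b := hU'
      rw [Finsupp.support_erase, Finset.mem_erase] at hU'b
      have hss : U' ⊂ U := (hmax U' hU'b.2).ssubset_of_ne hU'b.1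
      obtain ⟨v, hv, hvU'⟩ := Finset.exists_of_ssubset hss
      refine ⟨v, hv, ?_⟩
      rw [hsplit, barycenter_apply_of_mem hv, add_eq_left, flagSum, linearCombination_coord]
      refine Finset.sum_eq_zero fun s hs => ?_
      rw [barycenter_apply_of_notMem fun h => hvU' (hmax' s hs h), mul_zero]

/-- The weights on a flag are determined by the weighted sum of the barycentres. -/
theorem eq_of_flagSum_eq (hb : IsFlagWeight b) (hb' : IsFlagWeight b')
    (h : flagSum b = flagSum b') : b = b' := by
  classical
  induction hn : b.support.card using Nat.strong_induction_on generalizing b b' with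
  | _ n ih =>
    by_cases h0 : b = 0
    · subst h0
      refine (eq_zero_of_degree_eq_zero hb'.nonneg ?_).symm
      rw [← hb'.degree_flagSum, ← h]
      simp [flagSum]
    have h0' : b' ≠ 0 := by
      rintro rfl
      refine h0 (eq_zero_of_degree_eq_zero hb.nonneg ?_)
      rw [← hb.degree_flagSum, h]
      simp [flagSum]
    obtain ⟨U, hU, -, hsupp, ⟨v, hv, hvb⟩, hge⟩ := hb.exists_top h0
    obtain ⟨U', hU', -, hsupp', ⟨v', hv', hvb'⟩, hge'⟩ := hb'.exists_top h0'
    obtain rfl : U = U' := by rw [← hsupp, ← hsupp', h]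
    have hcard : 0 < ((U.card : ℝ))⁻¹ := by
      have : 0 < (U.card : ℝ) := by exact_mod_cast (hb.nonempty U hU).card_pos
      positivity
    have hbU : b U = b' U := by
      have h1 := hge v' hv'
      have h2 := hge' v hv
      rw [h, hvb'] at h1
      rw [← h, hvb] at h2
      exact le_antisymm (le_of_mul_le_mul_right h1 hcard) (le_of_mul_le_mul_right h2 hcard)
    have herase : b.erase U = b'.erase U := by
      refine ih _ ?_ (hb.erase U) (hb'.erase U) ?_ rfl
      · rw [← hn, Finsupp.support_erase]
        exact Finset.card_erase_lt_of_mem hU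
      · rw [← Finsupp.single_add_erase U b, ← Finsupp.single_add_erase U b', hbU, flagSum, flagSum,
          map_add, map_add] at h
        exact add_left_cancel h
    rw [← Finsupp.single_add_erase U b, ← Finsupp.single_add_erase U b', hbU, herase]

/-- Every non-negative function of finite support is a weighted sum of the barycentres of a flag:
that of its superlevel sets. All of these contain the points where the function is maximal. -/
theorem exists_flagSum_eq {g : V →₀ ℝ} (hg : ∀ v, 0 ≤ g v) :
    ∃ b : Finset V →₀ ℝ, IsFlagWeight b ∧ flagSum b = g ∧ (∀ s ∈ b.support, s ⊆ g.support) ∧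
      ∀ v, (∀ w, g w ≤ g v) → ∀ s ∈ b.support, v ∈ s := by
  classical
  induction hn : g.support.card using Nat.strong_induction_on generalizing g with
  | _ n ih =>
    by_cases h0 : g = 0
    · subst h0
      exact ⟨0, ⟨by simp, by simp, by simp⟩, by simp [flagSum], by simp, by simp⟩
    set U := g.support with hUdef
    have hUne : U.Nonempty := Finsupp.support_nonempty_iff.2 h0
    have hcard : 0 < (U.card : ℝ) := by exact_mod_cast hUne.card_pos
    obtain ⟨v₀, hv₀, hmin⟩ := U.exists_min_image g hUne
    have hpos : 0 < g v₀ := lt_of_le_of_ne (hg v₀) (Ne.symm (Finsupp.mem_support_iff.1 hv₀))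
    set g' : V →₀ ℝ := g - (g v₀ * U.card) • barycenter U with hg'def
    have hin : ∀ v ∈ U, g' v = g v - g v₀ := by
      intro v hv
      simp only [hg'def, Finsupp.coe_sub, Finsupp.coe_smul, Pi.sub_apply, Pi.smul_apply,
        barycenter_apply_of_mem hv, smul_eq_mul]
      field_simp
    have hout : ∀ v ∉ U, g' v = 0 := by
      intro v hv
      have : g v = 0 := Finsupp.notMem_support_iff.1 hv
      simp [hg'def, barycenter_apply_of_notMem hv, this]
    have hg' : ∀ v, 0 ≤ g' v := by
      intro v
      by_cases hv : v ∈ U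
      · rw [hin v hv]
        exact sub_nonneg.2 (hmin v hv)
      · exact (hout v hv).ge
    have hsub : g'.support ⊆ U.erase v₀ := by
      intro v hv
      have hvU : v ∈ U := by
        by_contra h
        exact Finsupp.mem_support_iff.1 hv (hout v h)
      refine Finset.mem_erase.2 ⟨?_, hvU⟩
      rintro rfl
      exact Finsupp.mem_support_iff.1 hv (by rw [hin v hvU, sub_self])
    obtain ⟨b, hb, hbg, hbs, hbmax⟩ := ih _ (by
      rw [← hn]
      exact (Finset.card_le_card hsub).trans_lt (Finset.card_erase_lt_of_mem hv₀)) hg' rfl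
    have hlt : ∀ s ∈ b.support, s ⊆ U := fun s hs =>
      (hbs s hs).trans (hsub.trans (Finset.erase_subset _ _))
    have hsupp : (b + Finsupp.single U (g v₀ * U.card)).support ⊆ insert U b.support := by
      refine Finsupp.support_add.trans (Finset.union_subset (Finset.subset_insert _ _) ?_)
      exact Finsupp.support_single_subset.trans (by simp)
    refine ⟨b + Finsupp.single U (g v₀ * U.card), ⟨fun s => ?_, fun s hs => ?_, ?_⟩, ?_,
      fun s hs => ?_, fun v hv s hs => ?_⟩
    · rw [Finsupp.add_apply, Finsupp.single_apply]
      have := hb.nonneg s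
      split_ifs <;> positivity
    · rcases Finset.mem_insert.1 (hsupp hs) with rfl | h
      · exact hUne
      · exact hb.nonempty s h
    · refine IsChain.mono (Finset.coe_subset.2 hsupp) ?_
      rw [Finset.coe_insert]
      exact hb.chain.insert fun s hs _ => Or.inr (hlt s hs)
    · have : flagSum (b + Finsupp.single U (g v₀ * U.card)) =
          g' + (g v₀ * U.card) • barycenter U := by
        rw [← hbg, flagSum, map_add, Finsupp.linearCombination_single, flagSum]
      rw [this, hg'def, sub_add_cancel]
    · rcases Finset.mem_insert.1 (hsupp hs) with rfl | h
      · exact Finset.Subset.refl _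
      · exact hlt s h
    · have hvU : v ∈ U := Finsupp.mem_support_iff.2 (lt_of_lt_of_le hpos (hv v₀)).ne'
      rcases Finset.mem_insert.1 (hsupp hs) with rfl | h
      · exact hvU
      · refine hbmax v (fun w => ?_) s h
        by_cases hw : w ∈ U
        · rw [hin v hvU, hin w hw]
          linarith [hv w]
        · rw [hout w hw]
          exact hg' v

end IsFlagWeight

end Barycenter

/-! ### The prism between a complex and its barycentric subdivision -/

section Prism

variable {V : Type*}

/-- The barycentric subdivision: its simplices are the flags of faces. -/
def barycentricSubdivision (P : PreAbstractSimplicialComplex V) :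
    PreAbstractSimplicialComplex (Finset V) where
  faces := {c | c.Nonempty ∧ IsChain (· ⊆ ·) (c : Set (Finset V)) ∧ ∀ s ∈ c, s ∈ P.faces}
  isRelLowerSet_faces := by
    intro c hc
    exact ⟨hc.1, fun d hdc hd => ⟨hd, hc.2.1.mono (Finset.coe_subset.2 hdc),
      fun s hs => hc.2.2 s (hdc hs)⟩⟩

/-- The triangulated prism over `P`, with `P` at the bottom and its barycentric subdivision at the
top: a simplex is the join of a face of `P` and of a flag of faces containing it, where one of the
two may be empty. -/
def prism (P : PreAbstractSimplicialComplex V) : PreAbstractSimplicialComplex (V ⊕ Finset V) where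
  faces := {s | s.Nonempty ∧ IsChain (· ⊆ ·) (s.toRight : Set (Finset V)) ∧
    (∀ t ∈ s.toRight, t ∈ P.faces ∧ s.toLeft ⊆ t) ∧ (s.toLeft.Nonempty → s.toLeft ∈ P.faces)}
  isRelLowerSet_faces := by
    intro s hs
    refine ⟨hs.1, fun t hts ht => ⟨ht, ?_, fun r hr => ?_, fun hl => ?_⟩⟩
    · exact hs.2.1.mono (Finset.coe_subset.2 (Finset.toRight_subset_toRight hts))
    · obtain ⟨h1, h2⟩ := hs.2.2.1 r (Finset.toRight_subset_toRight hts hr)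
      exact ⟨h1, (Finset.toLeft_subset_toLeft hts).trans h2⟩
    · exact (P.isRelLowerSet_faces (hs.2.2.2 (hl.mono (Finset.toLeft_subset_toLeft hts)))).2
        (Finset.toLeft_subset_toLeft hts) hl

/-- The position in `|P|` of the vertices of the prism. -/
noncomputable def prismVertex : V ⊕ Finset V → V →₀ ℝ :=
  Sum.elim (fun v => Finsupp.single v 1) barycenter

theorem linearCombination_prismVertex (a : V →₀ ℝ) (b : Finset V →₀ ℝ) :
    Finsupp.linearCombination ℝ prismVertex (a.sumElim b) = a + flagSum b := by
  rw [Finsupp.sumElim_eq_add, map_add, Finsupp.linearCombination_mapDomain,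
    Finsupp.linearCombination_mapDomain]
  congr 1
  simp [prismVertex, Function.comp_def, Finsupp.linearCombination_apply]

theorem prismVertex_nonneg (u : V ⊕ Finset V) (w : V) : 0 ≤ prismVertex u w := by
  classical
  rcases u with v | s
  · simp only [prismVertex, Sum.elim_inl, Finsupp.single_apply]
    split_ifs <;> norm_num
  · exact barycenter_nonneg s w

theorem degree_sumElim {W : Type*} (a : V →₀ ℝ) (b : W →₀ ℝ) :
    (a.sumElim b).degree = a.degree + b.degree := by
  classical
  rw [Finsupp.sumElim_eq_add, map_add]
  simp [Finsupp.degree_mapDomain]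

theorem toLeft_support_sumElim {W : Type*} (a : V →₀ ℝ) (b : W →₀ ℝ) :
    (a.sumElim b).support.toLeft = a.support := by
  ext v
  simp

theorem toRight_support_sumElim {W : Type*} (a : V →₀ ℝ) (b : W →₀ ℝ) :
    (a.sumElim b).support.toRight = b.support := by
  ext v
  simp

/-- The pair of the weights of a point of the prism at the vertices of `P` and at those of the
barycentric subdivision. -/
structure IsPrismWeight (P : PreAbstractSimplicialComplex V) (a : V →₀ ℝ)
    (b : Finset V →₀ ℝ) : Prop where
  nonneg : ∀ v, 0 ≤ a v
  flag : IsFlagWeight b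
  degree_add : a.degree + b.degree = 1
  mem : ∀ s ∈ b.support, s ∈ P.faces
  subset : ∀ s ∈ b.support, a.support ⊆ s
  support_mem : a.support.Nonempty → a.support ∈ P.faces

variable {P : PreAbstractSimplicialComplex V}

theorem exists_isPrismWeight (z : Realization (prism P)) :
    ∃ a b, z.1 = a.sumElim b ∧ IsPrismWeight P a b := by
  classical
  obtain ⟨a, b, hab⟩ : ∃ (a : V →₀ ℝ) (b : Finset V →₀ ℝ), z.1 = a.sumElim b :=
    ⟨_, _, (Finsupp.comapDomain_sumElim_comapDomain z.1).symm⟩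
  have hz := z.support_mem
  have hdeg : z.1.degree = 1 := z.sum_eq_one
  have h0 := z.nonneg
  rw [hab] at hz hdeg h0
  obtain ⟨h1, h2, h3, h4⟩ := hz
  rw [toRight_support_sumElim] at h2 h3
  rw [toLeft_support_sumElim] at h3 h4
  refine ⟨a, b, hab, fun v => h0 (Sum.inl v), ⟨fun s => h0 (Sum.inr s), fun s hs => ?_, h2⟩, ?_,
    fun s hs => (h3 s hs).1, fun s hs => (h3 s hs).2, h4⟩
  · exact (P.isRelLowerSet_faces (h3 s hs).1).1
  · rw [← hdeg, degree_sumElim]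

namespace IsPrismWeight

variable {a a' : V →₀ ℝ} {b b' : Finset V →₀ ℝ}

/-- The point of the realization of the prism with given weights. -/
noncomputable def toRealization (h : IsPrismWeight P a b) : Realization (prism P) :=
  ⟨a.sumElim b, by
    rintro (v | s)
    · exact h.nonneg v
    · exact h.flag.nonneg s, by
    have := h.degree_add
    rw [← degree_sumElim] at this
    exact this, by
    have hne : (a.sumElim b).support.Nonempty := by
      rw [Finsupp.support_nonempty_iff]
      intro h0
      have := h.degree_add
      rw [← degree_sumElim, h0] at this
      simp at this
    refine ⟨hne, ?_, ?_, ?_⟩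
    · rw [toRight_support_sumElim]
      exact h.flag.chain
    · rw [toRight_support_sumElim, toLeft_support_sumElim]
      exact fun s hs => ⟨h.mem s hs, h.subset s hs⟩
    · rw [toLeft_support_sumElim]
      exact h.support_mem⟩

/-- A point of the prism is determined by its position in `|P|` and its height. Indeed `flagSum b`
is the truncation of `a + flagSum b` at the level `∑ s, b s / #s`, and a truncation is determined
by its total weight. -/
theorem weights_eq (h : IsPrismWeight P a b) (h' : IsPrismWeight P a' b')
    (hbase : a + flagSum b = a' + flagSum b') (hdeg : b.degree = b'.degree) :
    a = a' ∧ b = b' := by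
  wlog hH : ∑ s ∈ b.support, b s * (s.card : ℝ)⁻¹ ≤ ∑ s ∈ b'.support, b' s * (s.card : ℝ)⁻¹
    generalizing a a' b b'
  · obtain ⟨h1, h2⟩ := this h' h hbase.symm hdeg.symm (le_of_not_ge hH)
    exact ⟨h1.symm, h2.symm⟩
  have hle : ∀ v, flagSum b v ≤ ∑ s ∈ b.support, b s * (s.card : ℝ)⁻¹ := by
    intro v
    rw [flagSum, linearCombination_coord]
    refine Finset.sum_le_sum fun s _ => mul_le_mul_of_nonneg_left ?_ (h.flag.nonneg s)
    by_cases hv : v ∈ s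
    · rw [barycenter_apply_of_mem hv]
    · rw [barycenter_apply_of_notMem hv]
      positivity
  have heq : ∀ v, a' v ≠ 0 → flagSum b' v = ∑ s ∈ b'.support, b' s * (s.card : ℝ)⁻¹ := by
    intro v hv
    rw [flagSum, linearCombination_coord]
    refine Finset.sum_congr rfl fun s hs => ?_
    rw [barycenter_apply_of_mem (h'.subset s hs (Finsupp.mem_support_iff.2 hv))]
  have hflag : flagSum b = flagSum b' := by
    refine eq_of_le_of_degree_eq (fun v => ?_) ?_
    · by_cases hv : a' v = 0
      · have h1 := DFunLike.congr_fun hbase v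
        rw [Finsupp.add_apply, Finsupp.add_apply, hv, zero_add] at h1
        linarith [h.nonneg v]
      · rw [heq v hv]
        exact (hle v).trans hH
    · rw [h.flag.degree_flagSum, h'.flag.degree_flagSum, hdeg]
  refine ⟨?_, h.flag.eq_of_flagSum_eq h'.flag hflag⟩
  rw [hflag] at hbase
  exact add_right_cancel hbase

end IsPrismWeight

/-- Every point of `|P| × [0, 1]` comes from a point of the prism: its upper part is a truncation of
the coordinates of the given point of `|P|`. -/
theorem exists_isPrismWeight_eq (x : Realization P) {t : ℝ} (ht : t ∈ Set.Icc (0 : ℝ) 1) :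
    ∃ a b, IsPrismWeight P a b ∧ a + flagSum b = x.1 ∧ b.degree = t := by
  classical
  have hx1 : ∀ v, x.1 v ≤ 1 := by
    intro v
    by_cases hv : v ∈ x.1.support
    · refine le_of_le_of_eq ?_ x.sum_eq_one
      exact Finset.single_le_sum (f := fun v => x.1 v) (fun v _ => x.nonneg v) hv
    · rw [Finsupp.notMem_support_iff.1 hv]
      norm_num
  -- The level `H` at which the coordinates are truncated is found by continuity.
  obtain ⟨H, hH, hHt⟩ : ∃ H ∈ Set.Icc (0 : ℝ) 1, ∑ v ∈ x.1.support, min (x.1 v) H = t := by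
    have hc : ContinuousOn (fun H => ∑ v ∈ x.1.support, min (x.1 v) H) (Set.Icc (0 : ℝ) 1) := by
      fun_prop
    refine intermediate_value_Icc zero_le_one hc ?_
    have e0 : ∑ v ∈ x.1.support, min (x.1 v) 0 = 0 :=
      Finset.sum_eq_zero fun v _ => min_eq_right (x.nonneg v)
    have e1 : ∑ v ∈ x.1.support, min (x.1 v) 1 = 1 := by
      refine Eq.trans ?_ x.sum_eq_one
      exact Finset.sum_congr rfl fun v _ => min_eq_left (hx1 v)
    simp only [e0, e1]
    exact ht
  let g : V →₀ ℝ := x.1.mapRange (fun r => min r H) (min_eq_left hH.1)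
  have hgv : ∀ v, g v = min (x.1 v) H := fun v => Finsupp.mapRange_apply
  have hg0 : ∀ v, 0 ≤ g v := fun v => by
    rw [hgv]
    exact le_min (x.nonneg v) hH.1
  have hgsupp : g.support ⊆ x.1.support := Finsupp.support_mapRange
  obtain ⟨b, hb, hbg, hbs, hbmax⟩ := IsFlagWeight.exists_flagSum_eq hg0
  have hbdeg : b.degree = t := by
    rw [← hb.degree_flagSum, hbg, degree_eq_sum_of_support_subset hgsupp, ← hHt]
    exact Finset.sum_congr rfl fun v _ => hgv v
  have hav : ∀ v, (x.1 - g) v = x.1 v - min (x.1 v) H := fun v => by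
    rw [Finsupp.sub_apply, hgv]
  have hasupp : (x.1 - g).support ⊆ x.1.support :=
    Finsupp.support_sub.trans (Finset.union_subset (Finset.Subset.refl _) hgsupp)
  refine ⟨x.1 - g, b, ⟨fun v => ?_, hb, ?_, fun s hs => ?_, fun s hs v hv => ?_, fun hne => ?_⟩,
    ?_, hbdeg⟩
  · rw [hav]
    exact sub_nonneg.2 (min_le_left _ _)
  · rw [map_sub, ← hbg, hb.degree_flagSum, sub_add_cancel]
    exact x.sum_eq_one
  · exact (P.isRelLowerSet_faces x.support_mem).2 ((hbs s hs).trans hgsupp) (hb.nonempty s hs)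
  · refine hbmax v (fun w => ?_) s hs
    rw [hgv, hgv]
    have : H ≤ x.1 v := by
      by_contra hlt
      rw [Finsupp.mem_support_iff, hav, min_eq_left (not_le.1 hlt).le, sub_self] at hv
      exact hv rfl
    rw [min_eq_right this]
    exact min_le_right _ _
  · exact (P.isRelLowerSet_faces x.support_mem).2 hasupp hne
  · rw [hbg, sub_add_cancel]

theorem prismVertex_support_subset {s : Finset (V ⊕ Finset V)} (hs : s ∈ (prism P).faces) :
    ∃ t ∈ P.faces, ∀ u ∈ s, (prismVertex u).support ⊆ t := by
  classical
  obtain ⟨h1, h2, h3, h4⟩ := hs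
  by_cases hr : s.toRight.Nonempty
  · obtain ⟨U, hU, hmax⟩ := exists_greatest_of_isChain h2 hr
    refine ⟨U, (h3 U hU).1, ?_⟩
    rintro (v | t) hu
    · refine Finsupp.support_single_subset.trans ?_
      rw [Finset.singleton_subset_iff]
      exact (h3 U hU).2 (Finset.mem_toLeft.2 hu)
    · exact (barycenter_support_subset t).trans (hmax t (Finset.mem_toRight.2 hu))
  · have hl : s.toLeft.Nonempty := by
      obtain ⟨v | t, hu⟩ := h1
      · exact ⟨v, Finset.mem_toLeft.2 hu⟩
      · exact absurd ⟨t, Finset.mem_toRight.2 hu⟩ hr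
    refine ⟨s.toLeft, h4 hl, ?_⟩
    rintro (v | t) hu
    · refine Finsupp.support_single_subset.trans ?_
      rw [Finset.singleton_subset_iff]
      exact Finset.mem_toLeft.2 hu
    · exact absurd ⟨t, Finset.mem_toRight.2 hu⟩ hr

/-- The affine projection of the prism over `P` to `|P|`. -/
noncomputable def prismBase (z : Realization (prism P)) : Realization P :=
  ⟨Finsupp.linearCombination ℝ prismVertex z.1,
    linearCombination_coord_nonneg z.nonneg prismVertex_nonneg, by
    obtain ⟨a, b, hab, h⟩ := exists_isPrismWeight z
    have := h.degree_add
    rw [← h.flag.degree_flagSum, ← map_add, ← linearCombination_prismVertex, ← hab] at this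
    exact this, by
    obtain ⟨t, ht, hst⟩ := prismVertex_support_subset z.support_mem
    refine (P.isRelLowerSet_faces ht).2 (fun w hw => ?_) ?_
    · by_contra hwt
      rw [Finsupp.mem_support_iff, linearCombination_coord] at hw
      refine hw (Finset.sum_eq_zero fun u hu => ?_)
      rw [Finsupp.notMem_support_iff.1 fun h => hwt (hst u hu h), mul_zero]
    · rw [Finsupp.support_nonempty_iff]
      intro h0
      obtain ⟨a, b, hab, h⟩ := exists_isPrismWeight z
      have := h.degree_add
      rw [← h.flag.degree_flagSum, ← map_add, ← linearCombination_prismVertex, ← hab, h0] at this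
      simp at this⟩

/-- The total weight of a point of the prism at the vertices of the barycentric subdivision. -/
noncomputable def prismHeight (z : Realization (prism P)) : ℝ :=
  z.1.sum fun u r => r * Sum.elim (fun _ => 0) (fun _ => 1) u

theorem prismBase_eq {z : Realization (prism P)} {a : V →₀ ℝ} {b : Finset V →₀ ℝ}
    (hz : z.1 = a.sumElim b) : (prismBase z).1 = a + flagSum b := by
  rw [← linearCombination_prismVertex, ← hz]
  rfl

theorem prismHeight_eq {z : Realization (prism P)} {a : V →₀ ℝ} {b : Finset V →₀ ℝ}
    (hz : z.1 = a.sumElim b) : prismHeight z = b.degree := by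
  have h1 : prismHeight z = Finsupp.linearCombination ℝ
      (Sum.elim (fun _ => (0 : ℝ)) (fun _ => 1)) (a.sumElim b) := by
    rw [← hz]
    rfl
  rw [h1, Finsupp.sumElim_eq_add, map_add, Finsupp.linearCombination_mapDomain,
    Finsupp.linearCombination_mapDomain]
  simp [Function.comp_def, Finsupp.linearCombination_apply, Finsupp.degree_apply, Finsupp.sum]

theorem prismHeight_mem (z : Realization (prism P)) : prismHeight z ∈ Set.Icc (0 : ℝ) 1 := by
  obtain ⟨a, b, hab, h⟩ := exists_isPrismWeight z
  rw [prismHeight_eq hab]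
  have h1 : 0 ≤ a.degree := Finset.sum_nonneg fun v _ => h.nonneg v
  have h2 : 0 ≤ b.degree := Finset.sum_nonneg fun v _ => h.flag.nonneg v
  exact ⟨h2, by linarith [h.degree_add]⟩

/-- The affine map from the realization of the prism over `P` to `|P| × [0, 1]`. -/
noncomputable def prismMap (z : Realization (prism P)) : Realization P × unitInterval :=
  (prismBase z, ⟨prismHeight z, prismHeight_mem z⟩)

theorem prismMap_bijective : Function.Bijective (prismMap (P := P)) := by
  constructor
  · intro z z' hzz
    obtain ⟨a, b, hab, h⟩ := exists_isPrismWeight z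
    obtain ⟨a', b', hab', h'⟩ := exists_isPrismWeight z'
    have h1 : a + flagSum b = a' + flagSum b' := by
      rw [← prismBase_eq hab, ← prismBase_eq hab']
      exact congrArg (fun p => p.1.1) hzz
    have h2 : b.degree = b'.degree := by
      rw [← prismHeight_eq hab, ← prismHeight_eq hab']
      exact congrArg (fun p => (p.2 : ℝ)) hzz
    obtain ⟨rfl, rfl⟩ := h.weights_eq h' h1 h2
    exact Subtype.ext (hab.trans hab'.symm)
  · rintro ⟨x, t⟩
    obtain ⟨a, b, h, hx, ht⟩ := exists_isPrismWeight_eq x t.2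
    refine ⟨h.toRealization, Prod.ext (Subtype.ext ?_) (Subtype.ext ?_)⟩
    · exact (prismBase_eq (z := h.toRealization) rfl).trans hx
    · exact (prismHeight_eq (z := h.toRealization) rfl).trans ht

theorem continuous_prismMap : Continuous (prismMap (P := P)) := by
  refine Continuous.prodMk ?_ (Continuous.subtype_mk ?_ _)
  · exact Realization.continuous_of_affine prismVertex (fun _ => rfl)
      fun s hs => prismVertex_support_subset hs
  · exact Realization.continuous_sum_mul _

theorem support_subset_of_prismBase {z : Realization (prism P)} {a : V →₀ ℝ} {b : Finset V →₀ ℝ}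
    (hz : z.1 = a.sumElim b) (h : IsPrismWeight P a b) :
    a.support ⊆ (prismBase z).1.support ∧ ∀ s ∈ b.support, s ⊆ (prismBase z).1.support := by
  rw [prismBase_eq hz]
  have hfl : (flagSum b).support ⊆ (a + flagSum b).support := by
    intro v hv
    have h1 := lt_of_le_of_ne (h.flag.flagSum_nonneg v) (Ne.symm (Finsupp.mem_support_iff.1 hv))
    rw [Finsupp.mem_support_iff, Finsupp.add_apply]
    linarith [h.nonneg v]
  constructor
  · intro v hv
    have h1 := lt_of_le_of_ne (h.nonneg v) (Ne.symm (Finsupp.mem_support_iff.1 hv))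
    rw [Finsupp.mem_support_iff, Finsupp.add_apply]
    linarith [h.flag.flagSum_nonneg v]
  · intro s hs
    have hb : b ≠ 0 := by
      rintro rfl
      simp at hs
    obtain ⟨U, -, hmax, hsupp, -⟩ := h.flag.exists_top hb
    exact (hmax s hs).trans (hsupp.symm.subset.trans hfl)

/-- The prism over `P` triangulates `|P| × [0, 1]`. -/
noncomputable def prismHomeomorph : Realization (prism P) ≃ₜ Realization P × unitInterval where
  toEquiv := Equiv.ofBijective prismMap prismMap_bijective
  continuous_toFun := continuous_prismMap
  continuous_invFun := by
    classical
    refine Realization.continuous_prod_of_closedSimplex fun s _ => ?_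
    refine continuousOn_of_leftInverse_of_isCompact continuous_prismMap
      (Equiv.ofBijective prismMap prismMap_bijective).left_inv
      (Realization.isCompact_closedSimplex (s.disjSum s.powerset)) ?_
    rintro p ⟨hp, -⟩
    obtain ⟨z, rfl⟩ := prismMap_bijective.2 p
    refine ⟨z, ?_, rfl⟩
    obtain ⟨a, b, hab, h⟩ := exists_isPrismWeight z
    obtain ⟨h1, h2⟩ := support_subset_of_prismBase hab h
    rw [Realization.mem_closedSimplex, Finset.subset_disjSum, hab, toLeft_support_sumElim,
      toRight_support_sumElim]
    exact ⟨h1.trans hp, fun t ht => Finset.mem_powerset.2 ((h2 t ht).trans hp)⟩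

theorem prismHomeomorph_apply (z : Realization (prism P)) : prismHomeomorph z = prismMap z := rfl

end Prism

/-! ### Subdivided simplicial maps and gluing of prisms -/

theorem SimplicialMap.image_mem_faces {V W : Type*} [DecidableEq W]
    {K : PreAbstractSimplicialComplex V} {L : PreAbstractSimplicialComplex W}
    (f : SimplicialMap K L) {s : Finset V} (hs : s ∈ K.faces) : s.image f.toFun ∈ L.faces := by
  obtain ⟨t, ht, hts⟩ := f.image_mem s hs
  rw [← Finset.coe_image] at hts
  rwa [← Finset.coe_injective hts]

theorem SimplicialMap.realize_injective {V W : Type*} {K : PreAbstractSimplicialComplex V}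
    {L : PreAbstractSimplicialComplex W} (f : SimplicialMap K L)
    (hf : Function.Injective f.toFun) : Function.Injective f.realize :=
  fun _ _ h => Subtype.ext (Finsupp.mapDomain_injective hf (congrArg Subtype.val h))

theorem SimplicialMap.exists_realize_eq {V W : Type*} {K : PreAbstractSimplicialComplex V}
    {L : PreAbstractSimplicialComplex W} (f : SimplicialMap K L)
    (hf : Function.Injective f.toFun) {s : Finset V} (hs : s ∈ K.faces) {x : Realization L}
    (hx : (x.1.support : Set W) ⊆ f.toFun '' (s : Set V)) :
    ∃ z ∈ closedSimplex K s, f.realize z = x := by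
  classical
  have hmap : Finsupp.mapDomain f.toFun (x.1.comapDomain f.toFun hf.injOn) = x.1 :=
    Finsupp.mapDomain_comapDomain _ hf _ (hx.trans (Set.image_subset_range _ _))
  have hsub : (x.1.comapDomain f.toFun hf.injOn).support ⊆ s := by
    intro v hv
    rw [Finsupp.comapDomain_support, Finset.mem_preimage] at hv
    obtain ⟨v', hv', he⟩ := hx hv
    rwa [← hf he]
  have hdeg : (x.1.comapDomain f.toFun hf.injOn).degree = 1 := by
    rw [← Finsupp.degree_mapDomain f.toFun, hmap]
    exact x.sum_eq_one
  refine ⟨⟨x.1.comapDomain f.toFun hf.injOn, fun v => x.nonneg _, hdeg,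
    (K.isRelLowerSet_faces hs).2 hsub ?_⟩, hsub, Subtype.ext hmap⟩
  rw [Finsupp.support_nonempty_iff]
  intro h0
  rw [h0] at hdeg
  simp at hdeg

theorem mapDomain_eq_single_of_forall {V W : Type*} {f : V → W} {p : W} (x : V →₀ ℝ)
    (h : ∀ v ∈ x.support, f v = p) : Finsupp.mapDomain f x = Finsupp.single p x.degree := by
  rw [Finsupp.mapDomain, Finsupp.sum, Finset.sum_congr rfl fun v hv => by rw [h v hv],
    ← Finsupp.single_finsetSum]
  rfl

/-- A choice of a vertex `c F` for each face `F` of `L` such that a face together with the chosen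
vertices of a flag of faces containing it spans a simplex. -/
def IsCentering {W : Type*} (L : PreAbstractSimplicialComplex W) (c : Finset W → W) : Prop :=
  ∀ (A : Finset W) (C : Finset (Finset W)) (D : Finset W), (A.Nonempty → A ∈ L.faces) →
    IsChain (· ⊆ ·) (C : Set (Finset W)) → (∀ F ∈ C, F ∈ L.faces ∧ A ⊆ F) →
    (D : Set W) = (A : Set W) ∪ c '' (C : Set (Finset W)) → D.Nonempty → D ∈ L.faces

section Subdivision

variable {V W : Type*} {P : PreAbstractSimplicialComplex V} {L : PreAbstractSimplicialComplex W}
  {c : Finset W → W}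

open Classical in
/-- The simplicial map on the prism over `P` which is `θ` at the bottom and sends a face `s` to the
centre of `θ s` at the top. -/
noncomputable def prismSimplicialMap (θ : SimplicialMap P L) (hc : IsCentering L c) :
    SimplicialMap (prism P) L where
  toFun := Sum.elim θ.toFun fun s => c (s.image θ.toFun)
  image_mem := by
    rintro s ⟨h1, h2, h3, h4⟩
    refine ⟨s.image (Sum.elim θ.toFun fun s => c (s.image θ.toFun)), ?_, Finset.coe_image⟩
    refine hc (s.toLeft.image θ.toFun) (s.toRight.image fun t => t.image θ.toFun) _
      (fun hne => θ.image_mem_faces (h4 (Finset.image_nonempty.1 hne))) ?_ ?_ ?_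
      (h1.image _)
    · rw [Finset.coe_image]
      rintro _ ⟨t, ht, rfl⟩ _ ⟨r, hr, rfl⟩ _
      exact (h2.total ht hr).imp Finset.image_subset_image Finset.image_subset_image
    · intro F hF
      obtain ⟨t, ht, rfl⟩ := Finset.mem_image.1 hF
      exact ⟨θ.image_mem_faces (h3 t ht).1, Finset.image_subset_image (h3 t ht).2⟩
    · ext w
      simp only [Finset.coe_image, Set.mem_image, SetLike.mem_coe, Set.mem_union, Sum.exists,
        Sum.elim_inl, Sum.elim_inr, Finset.mem_toLeft, Finset.mem_toRight]
      constructor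
      · rintro (⟨v, hv, rfl⟩ | ⟨t, ht, rfl⟩)
        · exact Or.inl ⟨v, hv, rfl⟩
        · exact Or.inr ⟨_, ⟨t, ht, rfl⟩, rfl⟩
      · rintro (⟨v, hv, rfl⟩ | ⟨_, ⟨t, ht, rfl⟩, rfl⟩)
        · exact Or.inl ⟨v, hv, rfl⟩
        · exact Or.inr ⟨t, ht, rfl⟩

/-- The top of the prism. -/
def subdivisionInclusion (P : PreAbstractSimplicialComplex V) :
    SimplicialMap (barycentricSubdivision P) (prism P) where
  toFun := Sum.inr
  image_mem := by
    rintro s ⟨h1, h2, h3⟩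
    refine ⟨s.map Function.Embedding.inr, ⟨h1.map, ?_, ?_, ?_⟩, Finset.coe_map _ _⟩
    · refine h2.mono fun t ht => ?_
      simpa using ht
    · intro t ht
      have ht' : t ∈ s := by simpa using ht
      refine ⟨h3 t ht', fun v hv => ?_⟩
      simp at hv
    · rintro ⟨v, hv⟩
      simp at hv

/-- The simplicial map on the barycentric subdivision that sends a face `s` to the centre of
`θ s`. -/
noncomputable def subdivisionMap (θ : SimplicialMap P L) (hc : IsCentering L c) :
    SimplicialMap (barycentricSubdivision P) L where
  toFun s := (prismSimplicialMap θ hc).toFun (Sum.inr s)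
  image_mem s hs := by
    obtain ⟨t, ht, hts⟩ := (subdivisionInclusion P).image_mem s hs
    obtain ⟨r, hr, hrt⟩ := (prismSimplicialMap θ hc).image_mem t ht
    refine ⟨r, hr, ?_⟩
    rw [hrt, hts, Set.image_image]
    rfl

theorem prismMap_eq_zero (x : Realization P) {z : Realization (prism P)}
    (hz : z.1 = Finsupp.mapDomain Sum.inl x.1) : prismMap z = (x, 0) := by
  have hz' : z.1 = x.1.sumElim (0 : Finset V →₀ ℝ) := by
    rw [hz, Finsupp.sumElim_eq_add]
    simp
  refine Prod.ext (Subtype.ext ?_) (Subtype.ext ?_)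
  · refine (prismBase_eq hz').trans ?_
    simp [flagSum]
  · refine (prismHeight_eq hz').trans ?_
    simp

theorem prismHomeomorph_symm_zero (x : Realization P) :
    (prismHomeomorph.symm (x, 0)).1 = Finsupp.mapDomain Sum.inl x.1 := by
  have hw : IsPrismWeight P x.1 (0 : Finset V →₀ ℝ) := by
    refine ⟨x.nonneg, ⟨by simp, by simp, by simp⟩, ?_, by simp, by simp, fun _ => x.support_mem⟩
    rw [map_zero, add_zero]
    exact x.sum_eq_one
  have hz : hw.toRealization.1 = Finsupp.mapDomain Sum.inl x.1 := by
    change x.1.sumElim 0 = _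
    rw [Finsupp.sumElim_eq_add]
    simp
  rw [← prismMap_eq_zero x hz, ← prismHomeomorph_apply, Homeomorph.symm_apply_apply, hz]

/-- The affine map from the realization of the barycentric subdivision to that of `P`. -/
noncomputable def subdivisionRealize (β : Realization (barycentricSubdivision P)) :
    Realization P :=
  prismBase ((subdivisionInclusion P).realize β)

theorem subdivisionInclusion_realize (β : Realization (barycentricSubdivision P)) :
    ((subdivisionInclusion P).realize β).1 = (0 : V →₀ ℝ).sumElim β.1 := by
  rw [Finsupp.sumElim_eq_add, Finsupp.mapDomain_zero, zero_add]
  rfl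

theorem prismMap_subdivisionInclusion (β : Realization (barycentricSubdivision P)) :
    prismMap ((subdivisionInclusion P).realize β) = (subdivisionRealize β, 1) := by
  refine Prod.ext rfl (Subtype.ext ?_)
  exact (prismHeight_eq (subdivisionInclusion_realize β)).trans β.sum_eq_one

theorem exists_subdivisionInclusion_eq {z : Realization (prism P)} {b : Finset V →₀ ℝ}
    (hz : z.1 = (0 : V →₀ ℝ).sumElim b) :
    ∃ β : Realization (barycentricSubdivision P), β.1 = b ∧
      (subdivisionInclusion P).realize β = z := by
  obtain ⟨a', b', hab, h⟩ := exists_isPrismWeight z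
  obtain ⟨rfl, rfl⟩ : a' = 0 ∧ b' = b := by
    have := Finsupp.sumFinsuppEquivProdFinsupp.symm.injective (a₁ := (a', b')) (a₂ := (0, b))
      (hab.symm.trans hz)
    exact Prod.mk.inj this
  have hdeg : b'.degree = 1 := by
    have := h.degree_add
    rwa [map_zero, zero_add] at this
  have hne : b'.support.Nonempty := by
    rw [Finsupp.support_nonempty_iff]
    rintro rfl
    simp at hdeg
  let β : Realization (barycentricSubdivision P) :=
    ⟨b', h.flag.nonneg, hdeg, hne, h.flag.chain, h.mem⟩
  refine ⟨β, rfl, Subtype.ext ?_⟩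
  rw [subdivisionInclusion_realize β, hz]

theorem exists_subdivisionInclusion_of_height {z : Realization (prism P)}
    (hz : (prismMap z).2 = 1) :
    ∃ β : Realization (barycentricSubdivision P), (subdivisionInclusion P).realize β = z := by
  obtain ⟨a, b, hab, h⟩ := exists_isPrismWeight z
  have h1 : b.degree = 1 := by
    rw [← prismHeight_eq hab]
    exact congrArg Subtype.val hz
  obtain rfl : a = 0 := eq_zero_of_degree_eq_zero h.nonneg (by linarith [h.degree_add])
  obtain ⟨β, -, hβ⟩ := exists_subdivisionInclusion_eq hab
  exact ⟨β, hβ⟩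

theorem subdivisionRealize_bijective : Function.Bijective (subdivisionRealize (P := P)) := by
  constructor
  · intro β β' h
    refine (subdivisionInclusion P).realize_injective Sum.inr_injective (prismMap_bijective.1 ?_)
    rw [prismMap_subdivisionInclusion, prismMap_subdivisionInclusion, h]
  · intro x
    obtain ⟨z, hz⟩ := prismMap_bijective.2 (x, (1 : unitInterval))
    obtain ⟨β, rfl⟩ := exists_subdivisionInclusion_of_height (congrArg Prod.snd hz)
    refine ⟨β, ?_⟩
    rw [prismMap_subdivisionInclusion] at hz
    exact congrArg Prod.fst hz

theorem continuous_subdivisionRealize : Continuous (subdivisionRealize (P := P)) :=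
  (continuous_fst.comp continuous_prismMap).comp (Realization.continuous_realize _)

/-- A complex and its barycentric subdivision have the same realization. -/
noncomputable def subdivisionHomeomorph :
    Realization (barycentricSubdivision P) ≃ₜ Realization P where
  toEquiv := Equiv.ofBijective subdivisionRealize subdivisionRealize_bijective
  continuous_toFun := continuous_subdivisionRealize
  continuous_invFun := by
    classical
    refine Realization.continuous_of_closedSimplex fun s _ => ?_
    refine continuousOn_of_leftInverse_of_isCompact continuous_subdivisionRealize
      (Equiv.ofBijective subdivisionRealize subdivisionRealize_bijective).left_inv
      (Realization.isCompact_closedSimplex s.powerset) ?_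
    intro x hx
    obtain ⟨β, rfl⟩ := subdivisionRealize_bijective.2 x
    refine ⟨β, ?_, rfl⟩
    obtain ⟨a, b, hab, h⟩ := exists_isPrismWeight ((subdivisionInclusion P).realize β)
    obtain rfl : b = β.1 := by
      have := Finsupp.sumFinsuppEquivProdFinsupp.symm.injective (a₁ := (a, b)) (a₂ := (0, β.1))
        (hab.symm.trans (subdivisionInclusion_realize β))
      exact (Prod.mk.inj this).2
    intro t ht
    exact Finset.mem_powerset.2 (((support_subset_of_prismBase hab h).2 t ht).trans hx)

theorem prismHomeomorph_symm_one (β : Realization (barycentricSubdivision P)) :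
    prismHomeomorph.symm (subdivisionHomeomorph β, 1) = (subdivisionInclusion P).realize β := by
  rw [Homeomorph.symm_apply_eq, prismHomeomorph_apply, prismMap_subdivisionInclusion]
  rfl

end Subdivision

/-- The map `θ : P → L` extends to a simplicial map on a triangulation of `|P| × [0, 1]` which is
constant at time `1`; moreover the triangulation contains `P` as a subcomplex at time `0`, so that
it can be glued below to other triangulations. -/
def HasTriangulatedNullHomotopy {V : Type u} {W : Type v} {P : PreAbstractSimplicialComplex V}
    {L : PreAbstractSimplicialComplex W} (θ : SimplicialMap P L) (p : W) : Prop :=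
  ∃ (U : Type u) (K : PreAbstractSimplicialComplex U)
    (φ : Realization K ≃ₜ Realization P × unitInterval) (h : SimplicialMap K L) (ι : V → U),
    Function.Injective ι ∧ (∀ v, h.toFun (ι v) = θ.toFun v) ∧
    (∀ x, (φ.symm (x, 0)).1 = Finsupp.mapDomain ι x.1) ∧
    ∀ z, (φ z).2 = 1 → (h.realize z).1 = Finsupp.single p 1

section Stacking

variable {V : Type u} {W : Type v} {P : PreAbstractSimplicialComplex V}
  {L : PreAbstractSimplicialComplex W} {c : Finset W → W}

open Classical in
theorem hasTriangulatedNullHomotopy_of_centers_eq (θ : SimplicialMap P L) (hc : IsCentering L c)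
    {p : W} (hp : ∀ s ∈ P.faces, c (s.image θ.toFun) = p) : HasTriangulatedNullHomotopy θ p := by
  refine ⟨V ⊕ Finset V, prism P, prismHomeomorph, prismSimplicialMap θ hc, Sum.inl,
    Sum.inl_injective, fun _ => rfl, prismHomeomorph_symm_zero, fun z hz => ?_⟩
  obtain ⟨β, rfl⟩ := exists_subdivisionInclusion_of_height hz
  have h1 : (((prismSimplicialMap θ hc).realize ((subdivisionInclusion P).realize β)).1 : W →₀ ℝ) =
      Finsupp.mapDomain (fun s => c (s.image θ.toFun)) β.1 := by
    change Finsupp.mapDomain _ (Finsupp.mapDomain _ _) = _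
    rw [← Finsupp.mapDomain_comp]
    rfl
  rw [h1, mapDomain_eq_single_of_forall (p := p)]
  · congr 1
    exact β.sum_eq_one
  · exact fun s hs => hp s (β.support_mem.2.2 s hs)

variable {U : Type u} {K : PreAbstractSimplicialComplex U}

open Classical in
/-- The prism over `P` and a complex `K` glued along the vertices `ι s` of `K`, where `s` runs over
the vertices of the barycentric subdivision of `P`. -/
noncomputable def stack (P : PreAbstractSimplicialComplex V) (K : PreAbstractSimplicialComplex U)
    (ι : Finset V → U) : PreAbstractSimplicialComplex (V ⊕ U) :=
  (prism P).map (Sum.map id ι) ⊔ K.map Sum.inr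

/-- The inclusion of the bottom layer. -/
def stackLower (P : PreAbstractSimplicialComplex V) (K : PreAbstractSimplicialComplex U)
    (ι : Finset V → U) : SimplicialMap (prism P) (stack P K ι) where
  toFun := Sum.map id ι
  image_mem s hs := by
    classical
    refine ⟨s.image (Sum.map id ι), Or.inl ⟨s, hs, ?_⟩, Finset.coe_image⟩
    congr

/-- The inclusion of the top layer. -/
def stackUpper (P : PreAbstractSimplicialComplex V) (K : PreAbstractSimplicialComplex U)
    (ι : Finset V → U) : SimplicialMap K (stack P K ι) where
  toFun := Sum.inr
  image_mem s hs := by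
    classical
    refine ⟨s.image Sum.inr, Or.inr ⟨s, hs, ?_⟩, Finset.coe_image⟩
    congr

theorem stackLower_realize {ι : Finset V → U} {z : Realization (prism P)} {a : V →₀ ℝ}
    {b : Finset V →₀ ℝ} (hz : z.1 = a.sumElim b) :
    ((stackLower P K ι).realize z).1 = a.sumElim (Finsupp.mapDomain ι b) := by
  change Finsupp.mapDomain _ z.1 = _
  rw [hz, Finsupp.sumElim_eq_add, Finsupp.sumElim_eq_add, Finsupp.mapDomain_add,
    ← Finsupp.mapDomain_comp, ← Finsupp.mapDomain_comp, ← Finsupp.mapDomain_comp]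
  rfl

theorem stackUpper_realize {ι : Finset V → U} (w : Realization K) :
    ((stackUpper P K ι).realize w).1 = (0 : V →₀ ℝ).sumElim w.1 := by
  rw [Finsupp.sumElim_eq_add, Finsupp.mapDomain_zero, zero_add]
  rfl

/-- The faces of a stack lie in one of the layers. -/
theorem exists_face_of_mem_stack {ι : Finset V → U} {t : Finset (V ⊕ U)}
    (ht : t ∈ (stack P K ι).faces) :
    (∃ s ∈ (prism P).faces, (t : Set (V ⊕ U)) = (stackLower P K ι).toFun '' s) ∨
      ∃ s ∈ K.faces, (t : Set (V ⊕ U)) = (stackUpper P K ι).toFun '' s := by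
  classical
  rcases ht with ⟨s, hs, rfl⟩ | ⟨s, hs, rfl⟩
  · exact Or.inl ⟨s, hs, Finset.coe_image⟩
  · exact Or.inr ⟨s, hs, Finset.coe_image⟩

variable (φ : Realization K ≃ₜ Realization (barycentricSubdivision P) × unitInterval)

/-- The time halved. -/
noncomputable def lowerHalf (t : unitInterval) : unitInterval :=
  ⟨(t : ℝ) / 2, by linarith [t.2.1], by linarith [t.2.2]⟩

/-- The time moved to the second half of the interval. -/
noncomputable def upperHalf (t : unitInterval) : unitInterval :=
  ⟨(1 + (t : ℝ)) / 2, by linarith [t.2.1], by linarith [t.2.2]⟩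

/-- The position in `|P| × [0, 1]` of the points of the bottom layer. -/
noncomputable def lowerPosition (z : Realization (prism P)) : Realization P × unitInterval :=
  ((prismHomeomorph z).1, lowerHalf (prismHomeomorph z).2)

/-- The position in `|P| × [0, 1]` of the points of the top layer. -/
noncomputable def upperPosition (w : Realization K) : Realization P × unitInterval :=
  (subdivisionHomeomorph (φ w).1, upperHalf (φ w).2)

theorem continuous_lowerPosition : Continuous (lowerPosition (P := P)) := by
  unfold lowerPosition lowerHalf
  fun_prop

theorem continuous_upperPosition : Continuous (upperPosition φ) := by
  unfold upperPosition upperHalf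
  fun_prop

/-- The inverse of the triangulation of `|P| × [0, 1]` by a stack. -/
noncomputable def stackMap (ι : Finset V → U) (p : Realization P × unitInterval) :
    Realization (stack P K ι) :=
  if (p.2 : ℝ) ≤ 1 / 2 then
    (stackLower P K ι).realize
      (prismHomeomorph.symm (p.1, Set.projIcc 0 1 zero_le_one (2 * (p.2 : ℝ))))
  else
    (stackUpper P K ι).realize
      (φ.symm (subdivisionHomeomorph.symm p.1, Set.projIcc 0 1 zero_le_one (2 * (p.2 : ℝ) - 1)))

variable {ι : Finset V → U}

/-- The two layers of a stack agree on the barycentric subdivision of `P`. -/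
theorem stackLower_subdivisionInclusion
    (hφ : ∀ x, (φ.symm (x, 0)).1 = Finsupp.mapDomain ι x.1)
    (β : Realization (barycentricSubdivision P)) :
    (stackLower P K ι).realize ((subdivisionInclusion P).realize β) =
      (stackUpper P K ι).realize (φ.symm (β, 0)) := by
  refine Subtype.ext ?_
  rw [stackLower_realize (subdivisionInclusion_realize β), stackUpper_realize, hφ]

theorem continuous_stackMap (hφ : ∀ x, (φ.symm (x, 0)).1 = Finsupp.mapDomain ι x.1) :
    Continuous (stackMap φ ι) := by
  refine Continuous.if_le ?_ ?_ (by fun_prop) continuous_const ?_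
  · refine (Realization.continuous_realize _).comp (prismHomeomorph.symm.continuous.comp ?_)
    exact continuous_fst.prodMk (continuous_projIcc.comp (by fun_prop))
  · refine (Realization.continuous_realize _).comp (φ.symm.continuous.comp ?_)
    exact (subdivisionHomeomorph.symm.continuous.comp continuous_fst).prodMk
      (continuous_projIcc.comp (by fun_prop))
  · rintro ⟨x, t⟩ ht
    simp only at ht ⊢
    have h1 : Set.projIcc (0 : ℝ) 1 zero_le_one (2 * (t : ℝ)) = 1 :=
      Set.projIcc_of_right_le _ (by rw [ht]; norm_num)
    have h0 : Set.projIcc (0 : ℝ) 1 zero_le_one (2 * (t : ℝ) - 1) = 0 :=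
      Set.projIcc_of_le_left _ (by rw [ht]; norm_num)
    rw [h1, h0, ← stackLower_subdivisionInclusion φ hφ, ← prismHomeomorph_symm_one,
      Homeomorph.apply_symm_apply]

theorem stackMap_lowerPosition (z : Realization (prism P)) :
    stackMap φ ι (lowerPosition z) = (stackLower P K ι).realize z := by
  have h : (((prismHomeomorph z).2 : unitInterval) : ℝ) / 2 ≤ 1 / 2 := by
    linarith [(prismHomeomorph z).2.2.2]
  simp only [stackMap, lowerPosition, lowerHalf, if_pos h, mul_div_cancel₀ _ (two_ne_zero' ℝ),
    Set.projIcc_val]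
  simp

theorem stackMap_upperPosition (hφ : ∀ x, (φ.symm (x, 0)).1 = Finsupp.mapDomain ι x.1)
    (w : Realization K) : stackMap φ ι (upperPosition φ w) = (stackUpper P K ι).realize w := by
  by_cases h : (φ w).2 = 0
  · -- The point lies on the common boundary of the two layers.
    have hw : w = φ.symm ((φ w).1, 0) := by
      rw [← h]
      simp
    have h2 : upperPosition φ w = lowerPosition ((subdivisionInclusion P).realize (φ w).1) := by
      have h3 : prismHomeomorph ((subdivisionInclusion P).realize (φ w).1) =
        (subdivisionRealize (φ w).1, 1) := prismMap_subdivisionInclusion _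
      rw [lowerPosition, h3, upperPosition, h]
      refine Prod.ext rfl (Subtype.ext ?_)
      simp [upperHalf, lowerHalf]
    rw [h2, stackMap_lowerPosition, stackLower_subdivisionInclusion φ hφ, ← hw]
  · have h1 : ¬ (1 + (((φ w).2 : unitInterval) : ℝ)) / 2 ≤ 1 / 2 := by
      have : 0 < (((φ w).2 : unitInterval) : ℝ) := unitInterval.pos_iff_ne_zero.2 h
      linarith
    have h2 : 2 * ((1 + (((φ w).2 : unitInterval) : ℝ)) / 2) - 1 = (φ w).2 := by ring
    simp only [stackMap, upperPosition, upperHalf, if_neg h1, h2, Set.projIcc_val]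
    simp

theorem exists_position (p : Realization P × unitInterval) :
    (∃ z, lowerPosition z = p) ∨ ∃ w, upperPosition φ w = p := by
  obtain ⟨x, t⟩ := p
  by_cases ht : (t : ℝ) ≤ 1 / 2
  · refine Or.inl ⟨prismHomeomorph.symm (x, ⟨2 * t, by linarith [t.2.1], by linarith⟩), ?_⟩
    rw [lowerPosition, Homeomorph.apply_symm_apply]
    refine Prod.ext rfl (Subtype.ext ?_)
    simp [lowerHalf]
  · refine Or.inr ⟨φ.symm (subdivisionHomeomorph.symm x,
      ⟨2 * t - 1, by linarith, by linarith [t.2.2]⟩), ?_⟩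
    rw [upperPosition, Homeomorph.apply_symm_apply]
    refine Prod.ext ?_ (Subtype.ext ?_)
    · simp
    · simp [upperHalf]

theorem lowerPosition_eq_upperPosition (hφ : ∀ x, (φ.symm (x, 0)).1 = Finsupp.mapDomain ι x.1)
    {z : Realization (prism P)} {w : Realization K}
    (h : (stackLower P K ι).realize z = (stackUpper P K ι).realize w) :
    lowerPosition z = upperPosition φ w := by
  obtain ⟨a, b, hab, -⟩ := exists_isPrismWeight z
  have h1 := congrArg Subtype.val h
  rw [stackLower_realize hab, stackUpper_realize] at h1
  have h2 := Prod.mk.inj (Finsupp.sumFinsuppEquivProdFinsupp.symm.injective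
    (a₁ := (a, Finsupp.mapDomain ι b)) (a₂ := (0, w.1)) h1)
  rw [h2.1] at hab
  obtain ⟨β, rfl, rfl⟩ := exists_subdivisionInclusion_eq hab
  have hw : w = φ.symm (β, 0) := Subtype.ext (by rw [hφ, h2.2])
  have h3 : prismHomeomorph ((subdivisionInclusion P).realize β) =
    (subdivisionRealize β, 1) := prismMap_subdivisionInclusion _
  rw [hw, lowerPosition, h3, upperPosition, Homeomorph.apply_symm_apply]
  refine Prod.ext rfl (Subtype.ext ?_)
  simp [upperHalf, lowerHalf]

theorem stackMap_bijective (hι : Function.Injective ι)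
    (hφ : ∀ x, (φ.symm (x, 0)).1 = Finsupp.mapDomain ι x.1) :
    Function.Bijective (stackMap φ ι) := by
  have hlow : Function.Injective (stackLower P K ι).toFun :=
    Function.Injective.sumMap Function.injective_id hι
  have hup : Function.Injective (stackUpper P K ι).toFun := Sum.inr_injective
  constructor
  · intro p q hpq
    rcases exists_position φ p with ⟨z, rfl⟩ | ⟨w, rfl⟩ <;>
    rcases exists_position φ q with ⟨z', rfl⟩ | ⟨w', rfl⟩
    · rw [stackMap_lowerPosition, stackMap_lowerPosition] at hpq
      rw [(stackLower P K ι).realize_injective hlow hpq]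
    · rw [stackMap_lowerPosition, stackMap_upperPosition φ hφ] at hpq
      exact lowerPosition_eq_upperPosition φ hφ hpq
    · rw [stackMap_lowerPosition, stackMap_upperPosition φ hφ] at hpq
      exact (lowerPosition_eq_upperPosition φ hφ hpq.symm).symm
    · rw [stackMap_upperPosition φ hφ, stackMap_upperPosition φ hφ] at hpq
      rw [(stackUpper P K ι).realize_injective hup hpq]
  · intro x
    rcases exists_face_of_mem_stack x.support_mem with ⟨s, hs, hxs⟩ | ⟨s, hs, hxs⟩
    · obtain ⟨z, -, rfl⟩ := (stackLower P K ι).exists_realize_eq hlow hs hxs.subset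
      exact ⟨_, stackMap_lowerPosition φ z⟩
    · obtain ⟨w, -, rfl⟩ := (stackUpper P K ι).exists_realize_eq hup hs hxs.subset
      exact ⟨_, stackMap_upperPosition φ hφ w⟩

/-- If `K` triangulates `|sd P| × [0, 1]` with `sd P` embedded at time `0`, then the stack of the
prism over `P` and of `K` triangulates `|P| × [0, 1]`. -/
noncomputable def stackHomeomorph (hι : Function.Injective ι)
    (hφ : ∀ x, (φ.symm (x, 0)).1 = Finsupp.mapDomain ι x.1) :
    Realization P × unitInterval ≃ₜ Realization (stack P K ι) where
  toEquiv := Equiv.ofBijective (stackMap φ ι) (stackMap_bijective φ hι hφ)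
  continuous_toFun := continuous_stackMap φ hφ
  continuous_invFun := by
    refine Realization.continuous_of_closedSimplex fun t ht => ?_
    have hleft := (Equiv.ofBijective (stackMap φ ι) (stackMap_bijective φ hι hφ)).left_inv
    rcases exists_face_of_mem_stack ht with ⟨s, hs, hts⟩ | ⟨s, hs, hts⟩
    · refine continuousOn_of_leftInverse_of_isCompact (continuous_stackMap φ hφ) hleft
        ((Realization.isCompact_closedSimplex s).image (continuous_lowerPosition (P := P))) ?_
      intro x hx
      obtain ⟨z, hz, rfl⟩ := (stackLower P K ι).exists_realize_eq
        (Function.Injective.sumMap Function.injective_id hι) hs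
        ((Finset.coe_subset.2 hx).trans hts.subset)
      exact ⟨_, ⟨z, hz, rfl⟩, stackMap_lowerPosition φ z⟩
    · refine continuousOn_of_leftInverse_of_isCompact (continuous_stackMap φ hφ) hleft
        ((Realization.isCompact_closedSimplex s).image (continuous_upperPosition φ)) ?_
      intro x hx
      obtain ⟨w, hw, rfl⟩ := (stackUpper P K ι).exists_realize_eq Sum.inr_injective hs
        ((Finset.coe_subset.2 hx).trans hts.subset)
      exact ⟨_, ⟨w, hw, rfl⟩, stackMap_upperPosition φ hφ w⟩

theorem stackHomeomorph_apply (hι : Function.Injective ι)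
    (hφ : ∀ x, (φ.symm (x, 0)).1 = Finsupp.mapDomain ι x.1) (p : Realization P × unitInterval) :
    stackHomeomorph φ hι hφ p = stackMap φ ι p := rfl

/-- The simplicial map on a stack which is `f` on the bottom layer and `g` on the top one. -/
def stackSimplicialMap (f : SimplicialMap (prism P) L) (g : SimplicialMap K L)
    (hfg : ∀ s, g.toFun (ι s) = f.toFun (Sum.inr s)) : SimplicialMap (stack P K ι) L where
  toFun := Sum.elim (fun v => f.toFun (Sum.inl v)) g.toFun
  image_mem t ht := by
    rcases exists_face_of_mem_stack ht with ⟨s, hs, hts⟩ | ⟨s, hs, hts⟩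
    · obtain ⟨r, hr, hrs⟩ := f.image_mem s hs
      refine ⟨r, hr, ?_⟩
      rw [hrs, hts, Set.image_image]
      refine Set.image_congr fun u _ => ?_
      rcases u with v | s
      · rfl
      · exact (hfg s).symm
    · obtain ⟨r, hr, hrs⟩ := g.image_mem s hs
      refine ⟨r, hr, ?_⟩
      rw [hrs, hts, Set.image_image]
      rfl

/-- A null homotopy of the subdivided and centred map yields one of the map itself. -/
theorem HasTriangulatedNullHomotopy.of_subdivisionMap {θ : SimplicialMap P L}
    (hc : IsCentering L c) {p : W} (h : HasTriangulatedNullHomotopy (subdivisionMap θ hc) p) :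
    HasTriangulatedNullHomotopy θ p := by
  obtain ⟨U, K, φ, g, ι, hι, hg, hφ, hp⟩ := h
  refine ⟨V ⊕ U, stack P K ι, (stackHomeomorph φ hι hφ).symm,
    stackSimplicialMap (prismSimplicialMap θ hc) g hg, Sum.inl, Sum.inl_injective, fun _ => rfl,
    fun x => ?_, fun z hz => ?_⟩
  · rw [Homeomorph.symm_symm, stackHomeomorph_apply]
    have h1 : lowerPosition (prismHomeomorph.symm (x, 0)) = (x, 0) := by
      rw [lowerPosition, Homeomorph.apply_symm_apply]
      refine Prod.ext rfl (Subtype.ext ?_)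
      simp [lowerHalf]
    rw [← h1, stackMap_lowerPosition]
    change Finsupp.mapDomain _ (prismHomeomorph.symm (x, 0)).1 = _
    rw [prismHomeomorph_symm_zero, ← Finsupp.mapDomain_comp]
    rfl
  · obtain ⟨⟨x, t⟩, rfl⟩ := (stackHomeomorph φ hι hφ).surjective z
    rw [Homeomorph.symm_apply_apply] at hz
    obtain rfl : t = 1 := hz
    have h1 : upperPosition φ (φ.symm (subdivisionHomeomorph.symm x, 1)) = (x, 1) := by
      rw [upperPosition, Homeomorph.apply_symm_apply]
      refine Prod.ext (by simp) (Subtype.ext ?_)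
      simp [upperHalf]
    rw [stackHomeomorph_apply, ← h1, stackMap_upperPosition φ hφ,
      ← hp (φ.symm (subdivisionHomeomorph.symm x, 1)) (by simp)]
    change Finsupp.mapDomain _ (Finsupp.mapDomain _ _) = _
    rw [← Finsupp.mapDomain_comp]
    rfl

end Stacking

/-! ### Approximate interpolation in asymptotically CAT(0) spaces -/

/-- Three distances satisfying the triangle inequalities are realized in the Euclidean plane. -/
theorem exists_euclidean_triangle {l a b : ℝ} (hl : 0 ≤ l) (ha : 0 ≤ a) (hb : 0 ≤ b)
    (h1 : l ≤ a + b) (h2 : a ≤ l + b) (h3 : b ≤ l + a) :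
    ∃ x y z : EuclideanSpace ℝ (Fin 2), dist x y = l ∧ dist x z = a ∧ dist y z = b := by
  rcases hl.eq_or_lt with rfl | hl
  · obtain rfl : a = b := by linarith
    refine ⟨0, 0, !₂[a, 0], by simp, ?_, ?_⟩ <;>
    simp [EuclideanSpace.norm_eq, Real.sqrt_sq ha]
  · set u := (l ^ 2 + a ^ 2 - b ^ 2) / (2 * l) with hu
    have hlu : 2 * l * u = l ^ 2 + a ^ 2 - b ^ 2 := by
      rw [hu]
      field_simp
    have hua : u ^ 2 ≤ a ^ 2 := by
      refine sq_le_sq' ?_ ?_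
      · nlinarith
      · nlinarith
    refine ⟨0, !₂[l, 0], !₂[u, √(a ^ 2 - u ^ 2)], ?_, ?_, ?_⟩
    · simp [EuclideanSpace.norm_eq, Real.sqrt_sq hl.le]
    · simp [EuclideanSpace.norm_eq, Real.sq_sqrt (sub_nonneg.2 hua), Real.sqrt_sq ha]
    · rw [EuclideanSpace.dist_eq, Fin.sum_univ_two]
      simp only [Real.dist_eq, sq_abs]
      rw [← Real.sqrt_sq hb]
      congr 1
      simp [Real.sq_sqrt (sub_nonneg.2 hua)]
      linarith [hlu]

/-- Stewart's theorem. -/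
theorem dist_lineMap_sq {E : Type*} [NormedAddCommGroup E] [InnerProductSpace ℝ E]
    (x y z : E) (r : ℝ) : dist (AffineMap.lineMap x y r) z ^ 2 =
      (1 - r) * dist x z ^ 2 + r * dist y z ^ 2 - r * (1 - r) * dist x y ^ 2 := by
  have h1 : AffineMap.lineMap x y r - z = (1 - r) • (x - z) + r • (y - z) := by
    rw [AffineMap.lineMap_apply_module]
    module
  have h2 : x - y = (x - z) - (y - z) := by abel
  rw [dist_eq_norm, dist_eq_norm, dist_eq_norm, dist_eq_norm, h1, h2]
  generalize x - z = p
  generalize y - z = q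
  rw [norm_add_sq_real, norm_sub_sq_real, norm_smul, norm_smul, inner_smul_left, inner_smul_right,
    mul_pow, mul_pow, Real.norm_eq_abs, Real.norm_eq_abs, sq_abs, sq_abs]
  simp only [conj_trivial]
  ring

namespace IsAsymptoticallyCAT0

variable {X : Type u} [MetricSpace X] {C : ℝ} {κ : ℝ → ℝ}

/-- For `0 ≤ r ≤ 1` there is a point `m` at distance about `r * dist x y` from `x` whose distances
to all points are, up to `κ`, at most those in Euclidean comparison triangles. -/
theorem exists_interpolation (hX : IsAsymptoticallyCAT0 X C κ) (x y : X) {r : ℝ}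
    (hr : r ∈ Set.Icc (0 : ℝ) 1) :
    ∃ m, dist m x ≤ r * dist x y + C ∧ ∀ z, ∃ D, 0 ≤ D ∧
      D ^ 2 = (1 - r) * dist x z ^ 2 + r * dist y z ^ 2 - r * (1 - r) * dist x y ^ 2 ∧
      dist m z ≤ D + 2 * κ (r * dist x y) := by
  have hC := hX.pos
  obtain ⟨a, γ, hγ, hγ0, hγa⟩ := hX.exists_quasiGeodesic x y
  set s := r * dist x y with hs
  have hs0 : 0 ≤ s := mul_nonneg hr.1 dist_nonneg
  have hsL : s ≤ dist x y := mul_le_of_le_one_left dist_nonneg hr.2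
  -- A parameter on the quasi-geodesic whose point is at distance about `s` from `x`.
  obtain ⟨t, ht, hts⟩ : ∃ t ∈ Set.Icc 0 a, |dist (γ t) x - s| ≤ C := by
    by_cases hsa : s ≤ a
    · refine ⟨s, ⟨hs0, hsa⟩, ?_⟩
      have := hγ.2 s ⟨hs0, hsa⟩ 0 ⟨le_rfl, hγ.1⟩
      rw [hγ0, sub_zero, abs_of_nonneg hs0] at this
      rw [abs_le]
      constructor <;> linarith [this.1, this.2]
    · have := hγ.2 a ⟨hγ.1, le_rfl⟩ 0 ⟨le_rfl, hγ.1⟩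
      rw [hγ0, hγa, sub_zero, abs_of_nonneg hγ.1, dist_comm] at this
      refine ⟨a, ⟨hγ.1, le_rfl⟩, ?_⟩
      rw [hγa, dist_comm, abs_le]
      push Not at hsa
      constructor <;> linarith [this.1, this.2]
  refine ⟨γ t, by linarith [(abs_le.1 hts).2], fun z => ?_⟩
  obtain ⟨a₀, γ₀, h₀, h₀0, h₀a⟩ := hX.exists_quasiGeodesic y z
  obtain ⟨a₁, γ₁, h₁, h₁0, h₁a⟩ := hX.exists_quasiGeodesic z x
  let Δ : QuasiGeodesicTriangle X C :=
    { vertex := ![x, y, z]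
      src := fun i => i + 1
      tgt := fun i => i + 2
      src_ne := by decide
      tgt_ne := by decide
      src_ne_tgt := by decide
      length := ![a₀, a₁, a]
      side := ![γ₀, γ₁, γ]
      isQuasiGeodesic := by
        intro i
        fin_cases i
        · exact h₀
        · exact h₁
        · exact hγ
      side_zero := by
        intro i
        fin_cases i
        · exact h₀0
        · exact h₁0
        · exact hγ0
      side_length := by
        intro i
        fin_cases i
        · exact h₀a
        · exact h₁a
        · exact hγa }
  obtain ⟨x', y', z', hxy, hxz, hyz⟩ := exists_euclidean_triangle (dist_nonneg (x := x) (y := y))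
    (dist_nonneg (x := x) (y := z)) (dist_nonneg (x := y) (y := z))
    (dist_triangle_right x y z) (dist_triangle x y z) (by
      rw [dist_comm x y]
      exact dist_triangle y x z)
  have hdist : ∀ i j, dist ((![x', y', z'] : Fin 3 → EuclideanSpace ℝ (Fin 2)) i)
      ((![x', y', z'] : Fin 3 → EuclideanSpace ℝ (Fin 2)) j) =
      dist (Δ.vertex i) (Δ.vertex j) := by
    intro i j
    fin_cases i <;> fin_cases j
    · exact (dist_self _).trans (dist_self _).symm
    · exact hxy
    · exact hxz
    · exact (dist_comm _ _).trans (hxy.trans (dist_comm _ _))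
    · exact (dist_self _).trans (dist_self _).symm
    · exact hyz
    · exact (dist_comm _ _).trans (hxz.trans (dist_comm _ _))
    · exact (dist_comm _ _).trans (hyz.trans (dist_comm _ _))
    · exact (dist_self _).trans (dist_self _).symm
  have hcat := hX.cat0 Δ _ hdist 2 1 t ht 0 ⟨le_rfl, h₁.1⟩ (AffineMap.lineMap x' y' r) z' ?_ ?_
  · refine ⟨dist (AffineMap.lineMap x' y' r) z', dist_nonneg, ?_, ?_⟩
    · rw [dist_lineMap_sq, hxy, hxz, hyz]
    · change dist (γ t) (γ₁ 0) ≤ _ + κ (min (dist x (γ t)) (dist (γ t) y) - C) +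
        κ (min (dist z (γ₁ 0)) (dist (γ₁ 0) x) - C) at hcat
      have e1 : κ (min (dist x (γ t)) (dist (γ t) y) - C) ≤ κ s := by
        refine hX.monotone ?_
        have := (min_le_left (dist x (γ t)) (dist (γ t) y)).trans_eq (dist_comm _ _)
        linarith [(abs_le.1 hts).2]
      have e2 : κ (min (dist z (γ₁ 0)) (dist (γ₁ 0) x) - C) ≤ κ s := by
        refine hX.monotone ?_
        have := min_le_left (dist z (γ₁ 0)) (dist (γ₁ 0) x)
        have h0 : dist z (γ₁ 0) = 0 := by rw [h₁0, dist_self]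
        linarith
      rw [h₁0] at hcat e2
      linarith
  · refine ⟨?_, ?_⟩
    · rw [segment_eq_image_lineMap]
      exact ⟨r, hr, rfl⟩
    · change |dist (γ t) x - dist (AffineMap.lineMap x' y' r) x'| ≤ C
      rw [dist_lineMap_left, hxy, Real.norm_of_nonneg hr.1]
      exact hts
  · refine ⟨left_mem_segment _ _ _, ?_⟩
    change |dist (γ₁ 0) z - dist z' z'| ≤ C
    rw [h₁0, dist_self, dist_self, sub_zero, abs_zero]
    exact hC.le

end IsAsymptoticallyCAT0

/-! ### Approximate circumcentres -/

section Eccentricity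

variable {X : Type u} [MetricSpace X]

/-- The radius of the smallest closed ball around `z` that contains `F`. -/
noncomputable def eccentricity (F : Finset X) (z : X) : ℝ :=
  (F.sup fun x => nndist z x : NNReal)

theorem eccentricity_nonneg (F : Finset X) (z : X) : 0 ≤ eccentricity F z := NNReal.coe_nonneg _

theorem dist_le_eccentricity {F : Finset X} {x : X} (hx : x ∈ F) (z : X) :
    dist z x ≤ eccentricity F z :=
  NNReal.coe_le_coe.2 (Finset.le_sup (f := fun x => nndist z x) hx)

theorem exists_eccentricity_eq {F : Finset X} (hF : F.Nonempty) (z : X) :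
    ∃ x ∈ F, eccentricity F z = dist z x := by
  obtain ⟨x, hx, h⟩ := F.exists_mem_eq_sup hF fun x => nndist z x
  exact ⟨x, hx, by rw [eccentricity, h, coe_nndist]⟩

theorem eccentricity_mono {F G : Finset X} (h : F ⊆ G) (z : X) :
    eccentricity F z ≤ eccentricity G z :=
  NNReal.coe_le_coe.2 (Finset.sup_mono h)

/-- `c` is a circumcentre of `F` up to an error of `ε` in the square of the radius. -/
def IsNearCircumcenter (ε : ℝ) (F : Finset X) (c : X) : Prop :=
  ∀ z, eccentricity F c ^ 2 ≤ eccentricity F z ^ 2 + ε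

theorem exists_isNearCircumcenter [Nonempty X] {ε : ℝ} (hε : 0 < ε) (F : Finset X) :
    ∃ c, IsNearCircumcenter ε F c := by
  have hbdd : BddBelow (Set.range fun z => eccentricity F z ^ 2) :=
    ⟨0, by
      rintro _ ⟨z, rfl⟩
      positivity⟩
  obtain ⟨c, hc⟩ := exists_lt_of_ciInf_lt
    (lt_add_of_pos_right (⨅ z, eccentricity F z ^ 2) hε)
  exact ⟨c, fun z => by linarith [ciInf_le hbdd z]⟩

/-- A choice of centres of the finite sets of diameter at most `T` which are close to the points of
the set and to the centres of its subsets, and closer to the base point `x₀` than the set. -/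
structure IsCenterChoice (T : ℝ) (x₀ : X) (c : Finset X → X) : Prop where
  dist_le : ∀ F : Finset X, (∀ x ∈ F, ∀ y ∈ F, dist x y ≤ T) → ∀ x ∈ F, dist x (c F) ≤ T
  dist_center_le : ∀ F G : Finset X, F.Nonempty → F ⊆ G → (∀ x ∈ G, ∀ y ∈ G, dist x y ≤ T) →
    dist (c F) (c G) ≤ T
  dist_base_le : ∀ F : Finset X, F.Nonempty → (∀ x ∈ F, ∀ y ∈ F, dist x y ≤ T) →
    ∀ ρ, (∀ x ∈ F, dist x₀ x ≤ ρ) → dist x₀ (c F) ≤ max (ρ - T / 64) 0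

end Eccentricity

namespace IsAsymptoticallyCAT0

variable {X : Type u} [MetricSpace X] {C T : ℝ} {κ : ℝ → ℝ}

theorem dist_sq_le_of_error {d D e T : ℝ} (hd : 0 ≤ d) (hD2 : D ≤ 2 * T)
    (he : 0 ≤ e) (heT : e ≤ T / 200000) (hdD : d ≤ D + 2 * e) : d ^ 2 ≤ D ^ 2 + T ^ 2 / 16384 := by
  have hT : 0 ≤ T := by linarith
  have h1 : d ^ 2 ≤ (D + 2 * e) ^ 2 := pow_le_pow_left₀ hd hdD 2
  have h2 : D * e ≤ 2 * T * e := mul_le_mul_of_nonneg_right hD2 he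
  have h3 : T * e ≤ T * (T / 200000) := mul_le_mul_of_nonneg_left heT hT
  have h4 : e * e ≤ T * (T / 200000) := (mul_le_mul_of_nonneg_right (by linarith) he).trans h3
  nlinarith [sq_nonneg T]

/-- The squared eccentricity is strongly convex up to an error. Hence its value at `z` bounds the
distance of `z` to a near minimum `c`. -/
theorem mul_dist_sq_le (hX : IsAsymptoticallyCAT0 X C κ) (hT : 0 < T)
    (hκ : κ (4 * T) ≤ T / 200000) {F : Finset X} (hF : F.Nonempty) {c z : X}
    (hc : IsNearCircumcenter (T ^ 2 / 16384) F c) (hc2 : eccentricity F c ≤ 2 * T)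
    (hz2 : eccentricity F z ≤ 2 * T) (hcz : dist c z ≤ 4 * T) {r : ℝ}
    (hr : r ∈ Set.Icc (0 : ℝ) 1) :
    r * (1 - r) * dist c z ^ 2 ≤
      r * (eccentricity F z ^ 2 - eccentricity F c ^ 2) + T ^ 2 / 8192 := by
  obtain ⟨m, -, hm⟩ := hX.exists_interpolation c z hr
  obtain ⟨x, hx, hxm⟩ := exists_eccentricity_eq hF m
  obtain ⟨D, hD, hD2, hDm⟩ := hm x
  have h1 : dist c x ^ 2 ≤ eccentricity F c ^ 2 :=
    pow_le_pow_left₀ dist_nonneg (dist_le_eccentricity hx c) 2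
  have h2 : dist z x ^ 2 ≤ eccentricity F z ^ 2 :=
    pow_le_pow_left₀ dist_nonneg (dist_le_eccentricity hx z) 2
  have hr0 := hr.1
  have hr1 := sub_nonneg.2 hr.2
  have h3 := mul_le_mul_of_nonneg_left h1 hr1
  have h4 := mul_le_mul_of_nonneg_left h2 hr0
  have hDT : D ≤ 2 * T := by
    refine abs_le_of_sq_le_sq' ?_ (by positivity) |>.2
    have h5 : eccentricity F c ^ 2 ≤ (2 * T) ^ 2 :=
      pow_le_pow_left₀ (eccentricity_nonneg _ _) hc2 2
    have h6 : eccentricity F z ^ 2 ≤ (2 * T) ^ 2 :=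
      pow_le_pow_left₀ (eccentricity_nonneg _ _) hz2 2
    have h7 := mul_le_mul_of_nonneg_left h5 hr1
    have h8 := mul_le_mul_of_nonneg_left h6 hr0
    have h9 : 0 ≤ r * (1 - r) * dist c z ^ 2 := by positivity
    linarith
  have hκ' : κ (r * dist c z) ≤ T / 200000 :=
    (hX.monotone ((mul_le_of_le_one_left dist_nonneg hr.2).trans hcz)).trans hκ
  have h10 := dist_sq_le_of_error dist_nonneg hDT (hX.nonneg _) hκ' hDm
  have h11 := hc m
  rw [hxm] at h11
  linarith

theorem eccentricity_le_two_mul (hT : 0 < T) {F : Finset X} (hF : F.Nonempty)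
    (hdiam : ∀ x ∈ F, ∀ y ∈ F, dist x y ≤ T) {c : X}
    (hc : IsNearCircumcenter (T ^ 2 / 16384) F c) : eccentricity F c ≤ 2 * T := by
  obtain ⟨x, hx⟩ := hF
  obtain ⟨y, hy, hxy⟩ := exists_eccentricity_eq ⟨x, hx⟩ x
  have h1 : eccentricity F x ^ 2 ≤ T ^ 2 := by
    rw [hxy]
    exact pow_le_pow_left₀ dist_nonneg (hdiam x hx y hy) 2
  refine abs_le_of_sq_le_sq' ?_ (by positivity) |>.2
  nlinarith [hc x]

/-- An approximate version of Jung's theorem. -/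
theorem eccentricity_sq_le (hX : IsAsymptoticallyCAT0 X C κ) (hT : 0 < T)
    (hκ : κ (4 * T) ≤ T / 200000) {F : Finset X} (hF : F.Nonempty)
    (hdiam : ∀ x ∈ F, ∀ y ∈ F, dist x y ≤ T) {c : X}
    (hc : IsNearCircumcenter (T ^ 2 / 16384) F c) :
    eccentricity F c ^ 2 ≤ 27 / 50 * T ^ 2 := by
  have hc2 := eccentricity_le_two_mul hT hF hdiam hc
  obtain ⟨x, hx, hcx⟩ := exists_eccentricity_eq hF c
  obtain ⟨y, hy, hxy⟩ := exists_eccentricity_eq hF x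
  have hxT : eccentricity F x ≤ T := hxy.trans_le (hdiam x hx y hy)
  have h1 : eccentricity F x ^ 2 ≤ T ^ 2 := pow_le_pow_left₀ (eccentricity_nonneg _ _) hxT 2
  have h2 := hX.mul_dist_sq_le hT hκ hF hc hc2 (z := x) (by linarith) (by linarith)
    (r := 1 / 8) (by norm_num)
  rw [← hcx] at h2
  have h3 : 0 < T ^ 2 := by positivity
  linarith

theorem dist_circumcenters_le (hX : IsAsymptoticallyCAT0 X C κ) (hT : 0 < T)
    (hκ : κ (4 * T) ≤ T / 200000) {F G : Finset X} (hF : F.Nonempty) (hFG : F ⊆ G)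
    (hdiam : ∀ x ∈ G, ∀ y ∈ G, dist x y ≤ T) {c c' : X}
    (hc : IsNearCircumcenter (T ^ 2 / 16384) F c)
    (hc' : IsNearCircumcenter (T ^ 2 / 16384) G c') : dist c c' ≤ 4 / 5 * T := by
  have hc2 := eccentricity_le_two_mul hT hF (fun x hx y hy => hdiam x (hFG hx) y (hFG hy)) hc
  have hc2' := (eccentricity_mono hFG c').trans
    (eccentricity_le_two_mul hT (hF.mono hFG) hdiam hc')
  have h1 := hX.eccentricity_sq_le hT hκ (hF.mono hFG) hdiam hc'
  have h2 : eccentricity F c' ^ 2 ≤ eccentricity G c' ^ 2 :=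
    pow_le_pow_left₀ (eccentricity_nonneg _ _) (eccentricity_mono hFG c') 2
  have h3 : dist c c' ≤ 4 * T := by
    obtain ⟨x, hx⟩ := hF
    have := dist_triangle_right c c' x
    linarith [dist_le_eccentricity hx c, dist_le_eccentricity hx c']
  have h4 := hX.mul_dist_sq_le hT hκ hF hc hc2 hc2' h3 (r := 1 / 8) (by norm_num)
  have h5 : 0 ≤ eccentricity F c ^ 2 := sq_nonneg _
  refine abs_le_of_sq_le_sq' ?_ (by positivity) |>.2
  have h6 : 0 < T ^ 2 := by positivity
  linarith

/-- Near circumcentres of subsets of a ball lie near the ball. -/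
theorem dist_circumcenter_le (hX : IsAsymptoticallyCAT0 X C κ) (hT : 0 < T)
    (hκ : κ (4 * T) ≤ T / 200000) {F : Finset X} (hF : F.Nonempty)
    (hdiam : ∀ x ∈ F, ∀ y ∈ F, dist x y ≤ T) {c : X}
    (hc : IsNearCircumcenter (T ^ 2 / 16384) F c) {x₀ : X} {ρ : ℝ}
    (hρ : ∀ x ∈ F, dist x₀ x ≤ ρ) : dist c x₀ ≤ ρ + T / 32 := by
  by_contra! hlt
  have hρ0 : 0 ≤ ρ := by
    obtain ⟨x, hx⟩ := hF
    exact dist_nonneg.trans (hρ x hx)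
  -- Moving `c` by `T / 64` towards `x₀` would decrease the eccentricity.
  set R := dist c x₀ with hR
  have hRpos : 0 < R := by linarith
  set r := T / 64 / R with hr
  have hrR : r * R = T / 64 := by
    rw [hr]
    field_simp
  have hr0 : 0 ≤ r := by positivity
  have hr1 : r ≤ 1 := by
    rw [hr, div_le_one hRpos]
    linarith
  obtain ⟨m, -, hm⟩ := hX.exists_interpolation c x₀ ⟨hr0, hr1⟩
  obtain ⟨x, hx, hxm⟩ := exists_eccentricity_eq hF m
  obtain ⟨D, hD, hD2, hDm⟩ := hm x
  rw [← hR] at hD2 hDm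
  have h1 : dist c x ^ 2 ≤ eccentricity F c ^ 2 :=
    pow_le_pow_left₀ dist_nonneg (dist_le_eccentricity hx c) 2
  have h2 : dist x₀ x ^ 2 ≤ ρ ^ 2 := pow_le_pow_left₀ dist_nonneg (hρ x hx) 2
  have h3 : r * dist x₀ x ^ 2 ≤ r * ρ ^ 2 := mul_le_mul_of_nonneg_left h2 hr0
  have h4 : 0 ≤ r * dist c x ^ 2 := by positivity
  have h5 : r * (R ^ 2 - ρ ^ 2) ≥ T / 64 * (T / 32) := by
    have e1 : R * (T / 32) ≤ R ^ 2 - ρ ^ 2 := by nlinarith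
    calc T / 64 * (T / 32) = r * (R * (T / 32)) := by rw [← mul_assoc, hrR]
      _ ≤ r * (R ^ 2 - ρ ^ 2) := mul_le_mul_of_nonneg_left e1 hr0
  have h6 : r * (1 - r) * R ^ 2 = r * R ^ 2 - (T / 64) ^ 2 := by
    rw [← hrR]
    ring
  have hDle : D ^ 2 ≤ eccentricity F c ^ 2 - T ^ 2 / 4096 := by
    rw [hD2, h6]
    linarith
  have hDT : D ≤ 2 * T := by
    refine abs_le_of_sq_le_sq' ?_ (by positivity) |>.2
    have : eccentricity F c ^ 2 ≤ (2 * T) ^ 2 := pow_le_pow_left₀ (eccentricity_nonneg _ _)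
      (eccentricity_le_two_mul hT hF hdiam hc) 2
    have h7 : 0 < T ^ 2 := by positivity
    linarith
  have hκ' : κ (r * R) ≤ T / 200000 := (hX.monotone (by rw [hrR]; linarith)).trans hκ
  have h10 := dist_sq_le_of_error dist_nonneg hDT (hX.nonneg _) hκ' hDm
  have h11 := hc m
  rw [hxm] at h11
  have h7 : 0 < T ^ 2 := by positivity
  linarith

/-- A point can be moved by about `T / 16` towards `x₀`, all the way if it is already close. -/
theorem exists_moved (hX : IsAsymptoticallyCAT0 X C κ) (hT : 0 < T)
    (hκ : κ (4 * T) ≤ T / 200000) (hCT : C ≤ T / 48) (x₀ c : X) :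
    ∃ c', dist c c' ≤ T / 12 ∧ (c' = x₀ ∨ dist x₀ c' ≤ dist c x₀ - 3 / 64 * T) := by
  by_cases h : dist c x₀ ≤ T / 16
  · exact ⟨x₀, by linarith, Or.inl rfl⟩
  push Not at h
  have hR : 0 < dist c x₀ := by linarith
  set r := T / 16 / dist c x₀ with hr
  have hrR : r * dist c x₀ = T / 16 := by
    rw [hr]
    field_simp
  have hr1 : r ≤ 1 := by
    rw [hr, div_le_one hR]
    exact h.le
  obtain ⟨m, hmc, hm⟩ := hX.exists_interpolation c x₀ ⟨by positivity, hr1⟩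
  obtain ⟨D, hD, hD2, hDm⟩ := hm x₀
  rw [hrR] at hmc hDm
  have hκ' : κ (T / 16) ≤ T / 200000 := (hX.monotone (by linarith)).trans hκ
  have hDeq : D = (1 - r) * dist c x₀ := by
    refine (pow_left_inj₀ hD (mul_nonneg (by linarith) hR.le) two_ne_zero).1 ?_
    rw [hD2, dist_self]
    ring
  refine ⟨m, ?_, Or.inr ?_⟩
  · rw [dist_comm]
    linarith
  · rw [dist_comm]
    linarith

theorem eventually_le_mul (hX : IsAsymptoticallyCAT0 X C κ) {ε : ℝ} (hε : 0 < ε) :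
    ∃ T₀, ∀ T ≥ T₀, κ T ≤ ε * T := by
  have h1 := (hX.sublinear.eventually (gt_mem_nhds hε)).and (eventually_gt_atTop 0)
  obtain ⟨T₀, hT₀⟩ := eventually_atTop.1 h1
  refine ⟨T₀, fun T hT => ?_⟩
  obtain ⟨h2, h3⟩ := hT₀ T hT
  exact ((div_lt_iff₀ h3).1 h2).le

/-- Near circumcentres, moved by a definite fraction of `T` towards the base point, are centres of
the finite sets of diameter at most `T`. -/
theorem exists_isCenterChoice (hX : IsAsymptoticallyCAT0 X C κ) :
    ∃ T₀ > 0, ∀ T ≥ T₀, ∀ x₀ : X, ∃ c : Finset X → X, IsCenterChoice T x₀ c := by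
  obtain ⟨T₁, hT₁⟩ := hX.eventually_le_mul (ε := 1 / 800000) (by norm_num)
  have hC := hX.pos
  refine ⟨max T₁ (48 * C), lt_max_of_lt_right (by linarith), fun T hT x₀ => ?_⟩
  have hTC : 48 * C ≤ T := (le_max_right _ _).trans hT
  have hTpos : 0 < T := by linarith
  have hκ : κ (4 * T) ≤ T / 200000 := by
    have := hT₁ (4 * T) (by linarith [(le_max_left T₁ (48 * C)).trans hT])
    linarith
  have : Nonempty X := ⟨x₀⟩
  choose a ha using exists_isNearCircumcenter (X := X) (ε := T ^ 2 / 16384) (by positivity)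
  choose f hf hf' using hX.exists_moved hTpos hκ (by linarith) x₀
  refine ⟨fun F => f (a F), fun F hd x hx => ?_, fun F G hF hFG hd => ?_, fun F hF hd ρ hρ => ?_⟩
  · have h1 : eccentricity F (a F) ≤ 3 / 4 * T := by
      refine abs_le_of_sq_le_sq' ?_ (by positivity) |>.2
      have := hX.eccentricity_sq_le hTpos hκ ⟨x, hx⟩ hd (ha F)
      nlinarith
    have h2 := dist_triangle_left x (f (a F)) (a F)
    linarith [hf (a F), dist_le_eccentricity hx (a F)]
  · have h1 := hX.dist_circumcenters_le hTpos hκ hF hFG hd (ha F) (ha G)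
    have h2 := dist_triangle4 (f (a F)) (a F) (a G) (f (a G))
    rw [dist_comm (f (a F)) (a F)] at h2
    linarith [hf (a F), hf (a G)]
  · rcases hf' (a F) with h | h
    · simp only [h, dist_self]
      exact le_max_right _ _
    · refine le_max_of_le_left ?_
      linarith [hX.dist_circumcenter_le hTpos hκ hF hd (ha F) hρ]

end IsAsymptoticallyCAT0

/-! ### Contraction by iterating a homotopy -/

section Iteration

variable {Y : Type*} (H : Y → ℝ → Y)

/-- The first `k` steps of the infinite concatenation of the homotopies `H`, `H ∘ H₁`,
`H ∘ H₁ ∘ H₁`, …, where `H₁ = H · 1`. -/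
noncomputable def iterateHomotopy : ℕ → Y → ℝ → Y
  | 0, x, _ => x
  | k + 1, x, t => if t ≤ 1 then H x t else iterateHomotopy k (H x 1) (t - 1)

variable {H}

theorem iterateHomotopy_of_nonpos (h0 : ∀ x, ∀ t ≤ 0, H x t = x) (k : ℕ) (x : Y) {t : ℝ}
    (ht : t ≤ 0) : iterateHomotopy H k x t = x := by
  cases k with
  | zero => rfl
  | succ k => rw [iterateHomotopy, if_pos (ht.trans zero_le_one), h0 x t ht]

theorem continuous_iterateHomotopy [TopologicalSpace Y] (h0 : ∀ x, ∀ t ≤ 0, H x t = x)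
    (hH : Continuous fun p : Y × ℝ => H p.1 p.2) (k : ℕ) :
    Continuous fun p : Y × ℝ => iterateHomotopy H k p.1 p.2 := by
  induction k with
  | zero => exact continuous_fst
  | succ k ih =>
    refine Continuous.if_le hH ?_ continuous_snd continuous_const ?_
    · exact ih.comp ((hH.comp (continuous_fst.prodMk continuous_const)).prodMk
        (continuous_snd.sub continuous_const))
    · rintro ⟨x, t⟩ ht
      simp only at ht ⊢
      rw [iterateHomotopy_of_nonpos h0 k _ (by rw [ht, sub_self]), ht]

theorem iterateHomotopy_succ (h0 : ∀ x, ∀ t ≤ 0, H x t = x) (k : ℕ) (x : Y) {t : ℝ}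
    (ht : t ≤ k) : iterateHomotopy H (k + 1) x t = iterateHomotopy H k x t := by
  induction k generalizing x t with
  | zero =>
    have ht' : t ≤ 0 := by simpa using ht
    rw [iterateHomotopy_of_nonpos h0 _ x ht', iterateHomotopy_of_nonpos h0 _ x ht']
  | succ k ih =>
    rw [iterateHomotopy]
    conv_rhs => rw [iterateHomotopy]
    split_ifs
    · rfl
    · push_cast at ht
      exact ih _ (by linarith)

theorem iterateHomotopy_of_le (h0 : ∀ x, ∀ t ≤ 0, H x t = x) {k l : ℕ} (hkl : k ≤ l) (x : Y)
    {t : ℝ} (ht : t ≤ k) : iterateHomotopy H l x t = iterateHomotopy H k x t := by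
  induction l, hkl using Nat.le_induction with
  | base => rfl
  | succ l hl ih =>
    rw [iterateHomotopy_succ h0 l x (ht.trans (by exact_mod_cast hl)), ih]

theorem iterateHomotopy_eq_of_mem {A : ℕ → Set Y} {p : Y} (hA0 : A 0 = {p})
    (hA : ∀ n, ∀ x ∈ A n, ∀ t, H x t ∈ A n) (hA1 : ∀ n, ∀ x ∈ A (n + 1), H x 1 ∈ A n)
    {n k : ℕ} (hnk : n ≤ k) {x : Y} (hx : x ∈ A n) {t : ℝ} (ht : n ≤ t) :
    iterateHomotopy H k x t = p := by
  have hp : ∀ s, H p s = p := by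
    intro s
    have := hA 0 p (by rw [hA0]; rfl) s
    rwa [hA0] at this
  induction k generalizing n x t with
  | zero =>
    obtain rfl : n = 0 := by omega
    rwa [hA0] at hx
  | succ k ih =>
    rw [iterateHomotopy]
    cases n with
    | zero =>
      rw [hA0] at hx
      obtain rfl : x = p := hx
      split_ifs with h
      · exact hp t
      · rw [hp 1]
        push Not at h
        exact ih (n := 0) (Nat.zero_le _) (by rw [hA0]; rfl) (by push_cast; linarith)
    | succ n =>
      push_cast at ht
      have h1 := hA1 n x hx
      split_ifs with h
      · have hn0 : (n : ℝ) ≤ 0 := by linarith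
        obtain rfl : n = 0 := by
          have : n ≤ 0 := by exact_mod_cast hn0
          omega
        obtain rfl : t = 1 := by
          push_cast at ht
          linarith
        rwa [hA0] at h1
      · exact ih (by omega) h1 (by linarith)

/-- Let `H` be a homotopy from the identity that preserves an increasing sequence of sets, the first
of which is a point, and whose end map moves each set into the previous one. If the index of a set
containing a point can be bounded continuously, then the space is contractible: run the infinite
concatenation of `H` with itself for a time given by the bound. -/
theorem contractibleSpace_of_shrinking [TopologicalSpace Y] (h0 : ∀ x, ∀ t ≤ 0, H x t = x)
    (hH : Continuous fun p : Y × ℝ => H p.1 p.2) {A : ℕ → Set Y} {p : Y} (hA0 : A 0 = {p})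
    (hA : ∀ n, ∀ x ∈ A n, ∀ t, H x t ∈ A n) (hA1 : ∀ n, ∀ x ∈ A (n + 1), H x 1 ∈ A n)
    {N : Y → ℝ} (hN : Continuous N) (hAN : ∀ x, ∃ n : ℕ, x ∈ A n ∧ n ≤ N x) :
    ContractibleSpace Y := by
  have hcont : Continuous fun q : Y × ℝ => iterateHomotopy H ⌈q.2⌉₊ q.1 q.2 := by
    rw [continuous_iff_continuousAt]
    rintro ⟨x, t⟩
    refine ((continuous_iterateHomotopy h0 hH (⌈t⌉₊ + 1)).continuousAt).congr ?_
    have hev : ∀ᶠ q : Y × ℝ in 𝓝 (x, t), q.2 < ⌈t⌉₊ + 1 :=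
      continuous_snd.continuousAt.eventually (gt_mem_nhds (by
        have := Nat.le_ceil t
        simp only
        linarith))
    filter_upwards [hev] with q hq
    refine iterateHomotopy_of_le h0 ?_ _ (Nat.le_ceil _)
    exact Nat.ceil_le.2 (by push_cast; exact hq.le)
  rw [contractible_iff_id_nullhomotopic]
  refine ⟨p, ⟨⟨⟨fun q => iterateHomotopy H ⌈(q.1 : ℝ) * N q.2⌉₊ q.2 (q.1 * N q.2), ?_⟩,
    fun x => ?_, fun x => ?_⟩⟩⟩
  · exact hcont.comp (continuous_snd.prodMk
      ((continuous_subtype_val.comp continuous_fst).mul (hN.comp continuous_snd)))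
  · exact iterateHomotopy_of_nonpos h0 _ x (by simp)
  · obtain ⟨n, hxn, hn⟩ := hAN x
    refine iterateHomotopy_eq_of_mem hA0 hA hA1 ?_ hxn ?_
    · have h1 : (n : ℝ) ≤ ⌈N x⌉₊ := hn.trans (Nat.le_ceil _)
      simpa using (by exact_mod_cast h1 : n ≤ ⌈N x⌉₊)
    · simpa using hn

end Iteration

/-! ### The homotopy of a realization given by centres -/

section CenterHomotopy

variable {W : Type*} {L : PreAbstractSimplicialComplex W} {c : Finset W → W}

/-- The homotopy from the identity of `|L|` to itself given by a choice of centres. -/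
noncomputable def centerHomotopy (hc : IsCentering L c)
    (x : Realization L) (t : ℝ) : Realization L :=
  (prismSimplicialMap (P := L) ⟨id, fun s hs => ⟨s, hs, by simp⟩⟩ hc).realize
    (prismHomeomorph.symm (x, Set.projIcc 0 1 zero_le_one t))

theorem continuous_centerHomotopy (hc : IsCentering L c) :
    Continuous fun p : Realization L × ℝ => centerHomotopy hc p.1 p.2 :=
  (Realization.continuous_realize _).comp (prismHomeomorph.symm.continuous.comp
    (continuous_fst.prodMk (continuous_projIcc.comp continuous_snd)))

theorem centerHomotopy_of_nonpos (hc : IsCentering L c)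
    (x : Realization L) (t : ℝ) (ht : t ≤ 0) : centerHomotopy hc x t = x := by
  refine Subtype.ext ?_
  change Finsupp.mapDomain _ (prismHomeomorph.symm (x, Set.projIcc 0 1 zero_le_one t)).1 = x.1
  rw [Set.projIcc_of_le_left _ ht]
  refine (congrArg _ (prismHomeomorph_symm_zero x)).trans ?_
  rw [← Finsupp.mapDomain_comp]
  exact Finsupp.mapDomain_id

/-- The vertices of the image of a point under the homotopy are vertices of its support and centres
of faces of its support; at time `1` only the latter occur. -/
theorem mem_support_centerHomotopy (hc : IsCentering L c)
    {x : Realization L} {t : ℝ} {w : W} (hw : w ∈ (centerHomotopy hc x t).1.support) :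
    (t < 1 ∧ w ∈ x.1.support) ∨ ∃ s ∈ L.faces, s ⊆ x.1.support ∧ c s = w := by
  classical
  set z : Realization (prism L) :=
    prismHomeomorph.symm (x, Set.projIcc 0 1 zero_le_one t) with hz
  have hzx : prismMap z = (x, Set.projIcc 0 1 zero_le_one t) := by
    rw [← prismHomeomorph_apply, hz, Homeomorph.apply_symm_apply]
  have hbase : prismBase z = x := congrArg Prod.fst hzx
  obtain ⟨a, b, hab, h⟩ := exists_isPrismWeight z
  obtain ⟨h1, h2⟩ := support_subset_of_prismBase hab h
  rw [hbase] at h1 h2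
  obtain ⟨u, hu, rfl⟩ := Finset.mem_image.1 (Finsupp.mapDomain_support hw)
  rcases u with v | s
  · have hv : v ∈ a.support := by
      have : v ∈ z.1.support.toLeft := Finset.mem_toLeft.2 hu
      rwa [hab, toLeft_support_sumElim] at this
    refine Or.inl ⟨?_, h1 hv⟩
    by_contra! ht
    rw [Set.projIcc_of_right_le _ ht] at hzx
    have hb : b.degree = 1 :=
      (prismHeight_eq hab).symm.trans (congrArg (fun q => (q.2 : ℝ)) hzx)
    have ha : a = 0 := eq_zero_of_degree_eq_zero h.nonneg (by linarith [h.degree_add])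
    simp [ha] at hv
  · have hs : s ∈ b.support := by
      have : s ∈ z.1.support.toRight := Finset.mem_toRight.2 hu
      rwa [hab, toRight_support_sumElim] at this
    refine Or.inr ⟨s, h.mem s hs, h2 s hs, ?_⟩
    simp [prismSimplicialMap]

end CenterHomotopy

/-! ### Null homotopies in Vietoris–Rips complexes -/

section VietorisRips

variable {X : Type u} [MetricSpace X] {T : ℝ} {x₀ : X} {c : Finset X → X} {B : Set X}

/-- Centres define simplicial homotopies inside the Vietoris–Rips complex of a ball `B` around the
base point; of `B` it matters only that it contains all points at most as far from `x₀` as one of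
its points. -/
theorem IsCenterChoice.isCentering (hc : IsCenterChoice T x₀ c) (hT : 0 ≤ T)
    (hB : ∀ b ∈ B, ∀ y, dist x₀ y ≤ dist x₀ b → y ∈ B) : IsCentering (vietorisRips T B) c := by
  intro A 𝓒 D hA hchain h𝓒 hD hne
  have hmem : ∀ w ∈ D, w ∈ A ∨ ∃ F ∈ 𝓒, c F = w := by
    intro w hw
    have : w ∈ (D : Set X) := hw
    rw [hD] at this
    exact this
  have hcc : ∀ F ∈ 𝓒, ∀ G ∈ 𝓒, dist (c F) (c G) ≤ T := by
    intro F hF G hG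
    rcases hchain.total hF hG with h | h
    · exact hc.dist_center_le F G (h𝓒 F hF).1.1 h (h𝓒 G hG).1.2.2
    · rw [dist_comm]
      exact hc.dist_center_le G F (h𝓒 G hG).1.1 h (h𝓒 F hF).1.2.2
  refine ⟨hne, fun w hw => ?_, fun w hw w' hw' => ?_⟩
  · rcases hmem w hw with h | ⟨F, hF, rfl⟩
    · exact (hA ⟨w, h⟩).2.1 h
    · obtain ⟨hFne, hFB, hFT⟩ := (h𝓒 F hF).1
      obtain ⟨b, hb, hmax⟩ := F.exists_max_image (dist x₀) hFne
      refine hB b (hFB hb) _ ((hc.dist_base_le F hFne hFT _ hmax).trans (max_le ?_ dist_nonneg))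
      linarith
  · rcases hmem w hw with h | ⟨F, hF, rfl⟩ <;> rcases hmem w' hw' with h' | ⟨G, hG, rfl⟩
    · exact (hA ⟨w, h⟩).2.2 w h w' h'
    · exact hc.dist_le G (h𝓒 G hG).1.2.2 w ((h𝓒 G hG).2 h)
    · rw [dist_comm]
      exact hc.dist_le F (h𝓒 F hF).1.2.2 w' ((h𝓒 F hF).2 h')
    · exact hcc F hF G hG

open Classical in
/-- The centre of the image of a face lies by `T / 64` closer to the base point than the image. -/
theorem IsCenterChoice.dist_center_image_le (hc : IsCenterChoice T x₀ c) {V : Type*}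
    {P : PreAbstractSimplicialComplex V} (θ : SimplicialMap P (vietorisRips T B)) {s : Finset V}
    (hs : s ∈ P.faces) {ρ : ℝ} (hρ : ∀ v ∈ s, dist x₀ (θ.toFun v) ≤ ρ) :
    dist x₀ (c (s.image θ.toFun)) ≤ max (ρ - T / 64) 0 := by
  obtain ⟨h1, -, h2⟩ := θ.image_mem_faces hs
  refine hc.dist_base_le _ h1 h2 ρ fun x hx => ?_
  obtain ⟨v, hv, rfl⟩ := Finset.mem_image.1 hx
  exact hρ v hv

/-- Repeatedly subdividing and passing to centres moves a simplicial map of bounded image to the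
constant map at the base point. -/
theorem IsCenterChoice.hasTriangulatedNullHomotopy (hc : IsCenterChoice T x₀ c) (hT : 0 ≤ T)
    (hB : ∀ b ∈ B, ∀ y, dist x₀ y ≤ dist x₀ b → y ∈ B) (n : ℕ) {V : Type v}
    {P : PreAbstractSimplicialComplex V} (θ : SimplicialMap P (vietorisRips T B))
    (hθ : ∀ s ∈ P.faces, ∀ v ∈ s, dist x₀ (θ.toFun v) ≤ n * (T / 64)) :
    HasTriangulatedNullHomotopy θ x₀ := by
  classical
  induction n generalizing V with
  | zero =>
    refine hasTriangulatedNullHomotopy_of_centers_eq θ (hc.isCentering hT hB) fun s hs => ?_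
    have h := hc.dist_center_image_le θ hs (hθ s hs)
    rw [Nat.cast_zero, zero_mul, max_eq_right (by linarith)] at h
    convert (dist_le_zero.1 h).symm
  | succ n ih =>
    refine HasTriangulatedNullHomotopy.of_subdivisionMap (hc.isCentering hT hB) (ih _ ?_)
    intro C hC s hs
    have h := hc.dist_center_image_le θ (hC.2.2 s hs) (hθ s (hC.2.2 s hs))
    push_cast at h
    rw [max_eq_left (by nlinarith)] at h
    refine le_trans (le_of_eq ?_) (h.trans (by linarith))
    simp only [subdivisionMap, prismSimplicialMap, Sum.elim_inr]

theorem HasTriangulatedNullHomotopy.simpliciallyHomotopicInside {V : Type u} {W : Type v}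
    {P : PreAbstractSimplicialComplex V} {L L' : PreAbstractSimplicialComplex W}
    {θ : SimplicialMap P L} {p : W} (h : HasTriangulatedNullHomotopy θ p)
    (hL : ∀ s ∈ L.faces, s ∈ L'.faces) {g : SimplicialMap P L'} (hg : ∀ v, g.toFun v = p) :
    SimpliciallyHomotopicInside L' θ g := by
  obtain ⟨U, K, φ, f, ι, -, hι, hφ, hp⟩ := h
  refine ⟨U, K, φ, ⟨f.toFun, fun s hs => ?_⟩, fun z hz => ?_, fun z hz => ?_⟩
  · obtain ⟨t, ht, hts⟩ := f.image_mem s hs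
    exact ⟨t, hL t ht, hts⟩
  · have h1 := hφ (φ z).1
    rw [← hz, Prod.mk.eta, Homeomorph.symm_apply_apply] at h1
    change Finsupp.mapDomain f.toFun z.1 = Finsupp.mapDomain θ.toFun (φ z).1.1
    rw [h1, ← Finsupp.mapDomain_comp]
    congr 1
    exact funext hι
  · refine (hp z hz).trans ?_
    change _ = Finsupp.mapDomain g.toFun (φ z).1.1
    rw [mapDomain_eq_single_of_forall (p := p) _ fun v _ => hg v]
    congr 1
    exact (φ z).1.sum_eq_one.symm

/-- The points of the realization all of whose vertices lie in the closed ball of radius `ρ` around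
`x₀`. -/
def realizationBall (T : ℝ) (x₀ : X) (ρ : ℝ) :
    Set (Realization (vietorisRips T (Set.univ : Set X))) :=
  {x | ∀ v ∈ x.1.support, dist x₀ v ≤ ρ}

theorem realizationBall_zero (hT : 0 ≤ T) : ∃ p, realizationBall T x₀ 0 = {p} := by
  let p : Realization (vietorisRips T (Set.univ : Set X)) :=
    ⟨Finsupp.single x₀ 1, fun v => by
      classical
      rw [Finsupp.single_apply]
      split_ifs <;> norm_num, by simp, by
      rw [Finsupp.support_single _ one_ne_zero]
      refine ⟨Finset.singleton_nonempty _, Set.subset_univ _, fun x hx y hy => ?_⟩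
      rw [Finset.mem_singleton.1 hx, Finset.mem_singleton.1 hy, dist_self]
      exact hT⟩
  refine ⟨p, Set.ext fun x => ⟨fun hx => ?_, ?_⟩⟩
  · have h1 : x.1 = Finsupp.mapDomain id x.1 := Finsupp.mapDomain_id.symm
    rw [mapDomain_eq_single_of_forall (f := id) (p := x₀) _
      fun v hv => (dist_le_zero.1 (hx v hv)).symm] at h1
    refine Subtype.ext (h1.trans ?_)
    change _ = Finsupp.single x₀ 1
    congr 1
    exact x.sum_eq_one
  · rintro rfl v hv
    rw [Finset.mem_singleton.1 (Finsupp.support_single_subset hv), dist_self]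

theorem IsCenterChoice.contractibleSpace (hc : IsCenterChoice T x₀ c) (hT : 0 < T) :
    ContractibleSpace (Realization (vietorisRips T (Set.univ : Set X))) := by
  have hcen : IsCentering (vietorisRips T (Set.univ : Set X)) c :=
    hc.isCentering hT.le fun _ _ _ _ => trivial
  have hη : 0 < T / 64 := by positivity
  obtain ⟨p, hp⟩ := realizationBall_zero (x₀ := x₀) hT.le
  have hcs : ∀ (ρ : ℝ) (x : Realization (vietorisRips T (Set.univ : Set X))),
      x ∈ realizationBall T x₀ ρ → ∀ s ∈ (vietorisRips T (Set.univ : Set X)).faces,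
      s ⊆ x.1.support → dist x₀ (c s) ≤ max (ρ - T / 64) 0 :=
    fun ρ x hx s hs hsx => hc.dist_base_le s hs.1 hs.2.2 ρ fun v hv => hx v (hsx hv)
  refine contractibleSpace_of_shrinking (H := centerHomotopy hcen)
    (A := fun n : ℕ => realizationBall T x₀ (n * (T / 64))) (p := p)
    (N := fun x => (x.1.sum fun v r => r * (dist x₀ v / (T / 64))) + 65)
    (centerHomotopy_of_nonpos hcen) (continuous_centerHomotopy hcen) ?_ ?_ ?_
    ((Realization.continuous_sum_mul _).add continuous_const) ?_
  · simpa using hp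
  · intro n x hx t w hw
    rcases mem_support_centerHomotopy hcen hw with ⟨-, h⟩ | ⟨s, hs, hsx, rfl⟩
    · exact hx w h
    · exact (hcs _ x hx s hs hsx).trans (max_le (by linarith) (by positivity))
  · intro n x hx w hw
    rcases mem_support_centerHomotopy hcen hw with ⟨h, -⟩ | ⟨s, hs, hsx, rfl⟩
    · exact absurd h (lt_irrefl 1)
    · refine (hcs _ x hx s hs hsx).trans (max_le ?_ (by positivity))
      push_cast
      linarith
  · intro x
    obtain ⟨v, hv, hmax⟩ := x.1.support.exists_max_image (dist x₀) x.support_mem.1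
    refine ⟨⌈dist x₀ v / (T / 64)⌉₊, fun w hw => ?_, ?_⟩
    · calc dist x₀ w ≤ dist x₀ v := hmax w hw
        _ = dist x₀ v / (T / 64) * (T / 64) := by field_simp
        _ ≤ _ := mul_le_mul_of_nonneg_right (Nat.le_ceil _) hη.le
    · -- All vertices of the support are within `T` of `v`, so their distances to `x₀` are
      -- at least `dist x₀ v - T`.
      have h1 : dist x₀ v / (T / 64) - 64 ≤
          x.1.sum fun w r => r * (dist x₀ w / (T / 64)) := by
        calc dist x₀ v / (T / 64) - 64
            = x.1.sum fun w r => r * (dist x₀ v / (T / 64) - 64) := by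
              rw [← Finsupp.sum_mul]
              refine (one_mul _).symm.trans ?_
              congr 1
              exact x.sum_eq_one.symm
          _ ≤ x.1.sum fun w r => r * (dist x₀ w / (T / 64)) := by
              refine Finset.sum_le_sum fun w hw => mul_le_mul_of_nonneg_left ?_ (x.nonneg w)
              have h2 := x.support_mem.2.2 w hw v hv
              have h3 := dist_triangle x₀ w v
              have h4 : dist x₀ v / (T / 64) - 64 = (dist x₀ v - T) / (T / 64) := by field_simp
              rw [h4]
              exact div_le_div_of_nonneg_right (by linarith) hη.le
      have h5 := (Nat.ceil_lt_add_one (by positivity : 0 ≤ dist x₀ v / (T / 64))).le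
      linarith

end VietorisRips

theorem theorem4p4 {X : Type u} [MetricSpace X] [Nonempty X] (C : ℝ) (κ : ℝ → ℝ)
    (hX : IsAsymptoticallyCAT0 X C κ) :
    (∃ T₀ : ℝ, ∀ T ≥ T₀, ContractibleSpace (Realization (vietorisRips T (Set.univ : Set X)))) ∧
    (∃ T₀ : ℝ, ∀ T ≥ T₀, ∀ B : Set X, IsMetricBall B →
      ∀ (V : Type v) (P : PreAbstractSimplicialComplex V)
        (θ : SimplicialMap P (vietorisRips T B)),
        ∃ g : SimplicialMap P (vietorisRips T (Metric.thickening (T + C) B)),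
          (∃ p : X, ∀ a, g.toFun a = p) ∧
          SimpliciallyHomotopicInside (vietorisRips T (Metric.thickening (T + C) B)) θ g) := by
  classical
  obtain ⟨T₀, hT₀, h⟩ := hX.exists_isCenterChoice
  refine ⟨⟨T₀, fun T hT => ?_⟩, ⟨T₀, fun T hT B hB V P θ => ?_⟩⟩
  · obtain ⟨c, hc⟩ := h T hT (Classical.arbitrary X)
    exact hc.contractibleSpace (hT₀.trans_le hT)
  · have hTpos : 0 < T := hT₀.trans_le hT
    obtain ⟨x₀, r, hr, hstar⟩ : ∃ (x₀ : X) (r : ℝ), (∀ b ∈ B, dist x₀ b ≤ r) ∧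
        ∀ b ∈ B, ∀ y, dist x₀ y ≤ dist x₀ b → y ∈ B := by
      obtain ⟨x₀, r, rfl | rfl⟩ := hB
      · exact ⟨x₀, r, fun b hb => Metric.mem_closedBall'.1 hb, fun b hb y hy =>
          Metric.mem_closedBall'.2 (hy.trans (Metric.mem_closedBall'.1 hb))⟩
      · exact ⟨x₀, r, fun b hb => (Metric.mem_ball'.1 hb).le, fun b hb y hy =>
          Metric.mem_ball'.2 (hy.trans_lt (Metric.mem_ball'.1 hb))⟩
    obtain ⟨c, hc⟩ := h T hT x₀
    have hsub : B ⊆ Metric.thickening (T + C) B :=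
      Metric.self_subset_thickening (by linarith [hX.pos]) B
    have hθB : ∀ s ∈ P.faces, ∀ v ∈ s, θ.toFun v ∈ B := fun s hs v hv =>
      (θ.image_mem_faces hs).2.1 (Finset.mem_image_of_mem _ hv)
    have hnull := hc.hasTriangulatedNullHomotopy hTpos.le hstar ⌈r / (T / 64)⌉₊ θ
      fun s hs v hv => by
        calc dist x₀ (θ.toFun v) ≤ r := hr _ (hθB s hs v hv)
          _ = r / (T / 64) * (T / 64) := by field_simp
          _ ≤ _ := mul_le_mul_of_nonneg_right (Nat.le_ceil _) (by positivity)
    have hle : ∀ s ∈ (vietorisRips T B).faces,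
        s ∈ (vietorisRips T (Metric.thickening (T + C) B)).faces :=
      fun s hs => ⟨hs.1, hs.2.1.trans hsub, hs.2.2⟩
    refine ⟨⟨fun _ => x₀, fun s hs => ?_⟩, ⟨x₀, fun _ => rfl⟩,
      hnull.simpliciallyHomotopicInside hle fun _ => rfl⟩
    obtain ⟨v, hv⟩ := (P.isRelLowerSet_faces hs).1
    refine ⟨{x₀}, ⟨Finset.singleton_nonempty _, ?_, fun x hx y hy => ?_⟩, ?_⟩
    · rw [Finset.coe_singleton, Set.singleton_subset_iff]
      exact hsub (hstar _ (hθB s hs v hv) x₀ (by simp))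
    · rw [Finset.mem_singleton.1 hx, Finset.mem_singleton.1 hy, dist_self]
      exact hTpos.le
    · rw [Finset.coe_singleton, Set.Nonempty.image_const ⟨v, hv⟩]
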